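/- Let $K$ be a field of characteristic zero, let $\partial=\frac{d}{dx}$, $\int: x^n\mapsto \frac{x^{n+1}}{n+1}$ ($n\ge 0$) and multiplication by $x$ be regarded as $K$-linear maps on $K[x]$, and let $\mathbb{I}_1=K\langle x,\partial,\int\rangle\subseteq \mathrm{End}_K(K[x])$ be the $K$-subalgebra they generate (the algebra of polynomial integro-differential operators). Let $F=\sum_{i,j\ge 0}K\left(\int^i\partial^j-\int^{i+1}\partial^{j+1}\right)\subseteq \mathbb{I}_1$ (this sum of $K$-subspaces is in fact direct). For $a\in\mathbb{I}_1$ let $\cdot a:\mathbb{I}_1\to\mathbb{I}_1$, $b\mapsto ba$, which is an endomorphism of the left $\mathbb{I}_1$-module $\mathbb{I}_1$, and let $a\cdot:\mathbb{I}_1\to\mathbb{I}_1$, $b\mapsto ab$, which is an endomorphism of the right $\mathbb{I}_1$-module $\mathbb{I}_1$. Let $l$ denote the length of left, respectively right, $\mathbb{I}_1$-modules. Then, for every $a\in\mathbb{I}_1$: 1. (a) $l(\ker(\cdot a))<\infty$ iff $l(\mathrm{coker}(\cdot a))<\infty$ iff $a\notin F$; (b) $l(\mathrm{im}(\cdot a))<\infty$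 iff $a\in F$. 2. (a) $l(\ker(a\cdot))<\infty$ iff $l(\mathrm{coker}(a\cdot))<\infty$ iff $a\notin F$; (b) $l(\mathrm{im}(a\cdot))<\infty$ iff $a\in F$. -/

import Mathlib

open Polynomial

/-- Integration on `K[x]`: the `K`-linear map `x ^ n ↦ x ^ (n + 1) / (n + 1)`. -/
noncomputable def polyInt (K : Type*) [Field K] : Module.End K K[X] :=
  Polynomial.lsum fun n => ((n : K) + 1)⁻¹ • Polynomial.monomial (n + 1)

theorem polyInt_X_pow (K : Type*) [Field K] (n : ℕ) :
    polyInt K (X ^ n) = C ((n : K) + 1)⁻¹ * X ^ (n + 1) := by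
  rw [← Polynomial.monomial_one_right_eq_X_pow, polyInt, Polynomial.lsum_apply,
    Polynomial.sum_monomial_index _ _ (by simp)]
  simp [Polynomial.C_mul_X_pow_eq_monomial, Polynomial.smul_monomial]

/-- Differentiation on `K[x]`. -/
noncomputable def polyDer (K : Type*) [Field K] : Module.End K K[X] :=
  Polynomial.derivative

/-- Multiplication by `x` on `K[x]`. -/
noncomputable def polyMulX (K : Type*) [Field K] : Module.End K K[X] :=
  LinearMap.mulLeft K X

/-- The subalgebra of `End_K(K[x])` generated by multiplication by `x`, `d/dx` and `∫`. -/
noncomputable def integroDiffSubalgebra (K : Type*) [Field K] :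
    Subalgebra K (Module.End K K[X]) :=
  Algebra.adjoin K {polyMulX K, polyDer K, polyInt K}

/-- The algebra `K⟨x, d/dx, ∫⟩` of polynomial integro-differential operators, as a type. It is
definitionally the subalgebra above with its inherited algebra structure; the separate name makes
instance search for its modules efficient. -/
def IntegroDiff (K : Type*) [Field K] : Type _ := integroDiffSubalgebra K

namespace IntegroDiff

noncomputable instance (K : Type*) [Field K] : Ring (IntegroDiff K) :=
  inferInstanceAs (Ring (integroDiffSubalgebra K))

noncomputable instance (K : Type*) [Field K] : Algebra K (IntegroDiff K) :=
  inferInstanceAs (Algebra K (integroDiffSubalgebra K))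

/-- `d/dx` as an element of the algebra of integro-differential operators. -/
noncomputable def der (K : Type*) [Field K] : IntegroDiff K :=
  (⟨polyDer K, Algebra.subset_adjoin (by simp)⟩ : integroDiffSubalgebra K)

/-- `∫` as an element of the algebra of integro-differential operators. -/
noncomputable def int (K : Type*) [Field K] : IntegroDiff K :=
  (⟨polyInt K, Algebra.subset_adjoin (by simp)⟩ : integroDiffSubalgebra K)

/-- `e i j = ∫ ^ i ∂ ^ j - ∫ ^ (i + 1) ∂ ^ (j + 1)`. -/
noncomputable def e (K : Type*) [Field K] (i j : ℕ) : IntegroDiff K :=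
  int K ^ i * der K ^ j - int K ^ (i + 1) * der K ^ (j + 1)

/-- The sum over all `i, j` of the lines `K e i j`. -/
noncomputable def F (K : Type*) [Field K] : Submodule K (IntegroDiff K) :=
  ⨆ (i : ℕ) (j : ℕ), Submodule.span K {e K i j}

end IntegroDiff

/-- Right multiplication `b ↦ b * a`, an endomorphism of the left module `R`. -/
def rightMulMap {R : Type*} [Ring R] (a : R) : R →ₗ[R] R where
  toFun b := b * a
  map_add' b c := add_mul b c a
  map_smul' r b := mul_assoc r b a

/-- Left multiplication `b ↦ a * b`, an endomorphism of the right module `R`, right modules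
being left modules over the opposite ring (`MulOpposite.op r • b = b * r`). -/
def leftMulMap {R : Type*} [Ring R] (a : R) : R →ₗ[Rᵐᵒᵖ] R where
  toFun b := a * b
  map_add' b c := mul_add a b c
  map_smul' r b := (mul_assoc a b r.unop).symm

/-! Write `D` for the derivative, `I` for integration, `H = D * x` and `P = 1 - I * D`, the
projection onto constants. These satisfy relations (`IsIntegroDiffGen`) that survive passage to the
opposite algebra with `D` and `I` exchanged. Membership of `a` in `F` has a symmetric form as well:
some `D ^ n * a` vanishes, equivalently some `a * I ^ n` vanishes. Hence only left modules need be
treated.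

Lengths are bounded by growth, as for holonomic modules. Let `V` be the span of `1, D, I, H`. In
characteristic zero a nonzero vector `v` of any module has at least linear growth: `V ^ (n + c) • v`
has dimension at least `n` (`exists_linearIndependent_smul`). So every strict step in a chain of
submodules consumes a linear amount of dimension, and a filtration of dimension at most `c * n + b`
forces length at most `c` (`IsLinearFiltration.length_lt_top`).

The kernel of right multiplication by `I ^ J` has linear growth. If `a` is in `F`, the image of
right multiplication by `a` lies in such a kernel. If `a` is not in `F`, its kernel does
(`exists_ker_le_ker_I_pow`): some `D ^ n * a` is a differential operator with nonzero leading
coefficient, which excludes annihilators outside `F` and bounds the power of `I` needed. The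
cokernel then also grows linearly, because the growth of the algebra itself is at most quadratic.
Finally the algebra has infinite length, so additivity of length yields the converses. -/

/-- Translates are irreducible with the same leading coefficient, so if not coprime they are equal.
Then `q` has the nonzero period `d - c`, takes one value infinitely often in characteristic zero,
and is constant. -/
theorem isCoprime_comp_X_add_C {K : Type*} [Field K] [CharZero K] {q : K[X]} (hq : Irreducible q)
    {c d : K} (hcd : c ≠ d) : IsCoprime (q.comp (X + C c)) (q.comp (X + C d)) := by
  have hirr : ∀ c : K, Irreducible (q.comp (X + C c)) := fun c => by
    have := (MulEquiv.irreducible_iff (algEquivAevalXAddC c)).2 hq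
    simpa [algEquivAevalXAddC, aeval_def, comp, algebraMap_eq] using this
  rw [(hirr c).coprime_iff_not_dvd, (hirr c).dvd_irreducible_iff_associated (hirr d)]
  rintro ⟨u, hu⟩
  obtain ⟨r, hr, hru⟩ := Polynomial.isUnit_iff.1 u.isUnit
  rw [← hru] at hu
  have hlc := congrArg leadingCoeff hu
  rw [leadingCoeff_mul, leadingCoeff_C, leadingCoeff_comp (by simp), leadingCoeff_comp (by simp)]
    at hlc
  have hr1 : r = 1 := by
    have h0 : q.leadingCoeff ≠ 0 := leadingCoeff_ne_zero.2 hq.ne_zero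
    simpa [h0] using hlc
  subst hr1
  have hper : ∀ x, q.eval (x + c) = q.eval (x + d) := fun x => by
    simpa using congrArg (eval x) hu
  have hzero : ∀ n : ℕ, q.eval (n * (d - c)) = q.eval 0 := fun n => by
    induction n with
    | zero => simp
    | succ n ih =>
      rw [← ih]
      have := hper (n * (d - c) - c)
      rw [sub_add_cancel] at this
      rw [this]
      congr 1
      push_cast
      ring
  have hconst : q = C (q.eval 0) := by
    refine eq_of_infinite_eval_eq _ _ (Set.Infinite.mono ?_
      (Set.infinite_range_of_injective (f := fun n : ℕ => (n : K) * (d - c)) ?_))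
    · rintro _ ⟨n, rfl⟩
      simp [hzero]
    · intro m n hmn
      simpa [sub_ne_zero.2 hcd.symm] using hmn
  have := hq.natDegree_pos
  rw [hconst, natDegree_C] at this
  exact lt_irrefl _ this

theorem mul_aeval_of_mul_eq {K R : Type*} [Field K] [Ring R] [Algebra K R] {x y z : R}
    (h : x * y = z * x) (p : K[X]) : x * aeval y p = aeval z p * x := by
  induction p using Polynomial.induction_on' with
  | add p q hp hq => simp [mul_add, add_mul, hp, hq]
  | monomial n c =>
    have : x * y ^ n = z ^ n * x := SemiconjBy.pow_right h n
    rw [aeval_monomial, aeval_monomial, mul_assoc, ← this, ← mul_assoc, ← mul_assoc,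
      Algebra.commutes]

/-! ### Abstract presentation and the filtration by powers of the generating space -/

/-- A presentation of the algebra of integro-differential operators by `D = ∂`, `I = ∫`,
`H = ∂ x` and the projection `P = 1 - ∫ ∂`. It is symmetric under passing to the opposite
algebra and exchanging `D` and `I`. -/
structure IsIntegroDiffGen (K : Type*) {R : Type*} [Field K] [Ring R] [Algebra K R]
    (D I H P : R) : Prop where
  D_mul_I : D * I = 1
  I_mul_D : I * D = 1 - P
  H_mul_I : H * I = I * (H + 1)
  D_mul_H : D * H = (H + 1) * D
  H_mul_P : H * P = P
  P_mul_H : P * H = P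
  P_ne_zero : P ≠ 0
  adjoin_eq_top : Algebra.adjoin K {D, I, H} = ⊤

/-- The span of the generators and `1`. -/
def genSpan (K : Type*) {R : Type*} [Field K] [Ring R] [Algebra K R] (D I H : R) :
    Submodule K R :=
  Submodule.span K {1, D, I, H}

section genSpan

variable {K R : Type*} [Field K] [Ring R] [Algebra K R] {D I H : R}

theorem one_mem_genSpan : (1 : R) ∈ genSpan K D I H := Submodule.subset_span (by simp)
theorem D_mem_genSpan : D ∈ genSpan K D I H := Submodule.subset_span (by simp)
theorem I_mem_genSpan : I ∈ genSpan K D I H := Submodule.subset_span (by simp)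
theorem H_mem_genSpan : H ∈ genSpan K D I H := Submodule.subset_span (by simp)

theorem genSpan_pow_mono : Monotone fun n : ℕ => genSpan K D I H ^ n :=
  fun _ _ h => pow_le_pow_right₀ (Submodule.one_le.2 one_mem_genSpan) h

theorem mem_genSpan_pow_of_le {m n : ℕ} (h : m ≤ n) {a : R} (ha : a ∈ genSpan K D I H ^ m) :
    a ∈ genSpan K D I H ^ n :=
  genSpan_pow_mono h ha

theorem mul_mem_genSpan_pow {m n : ℕ} {a b : R} (ha : a ∈ genSpan K D I H ^ m)
    (hb : b ∈ genSpan K D I H ^ n) : a * b ∈ genSpan K D I H ^ (m + n) := by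
  rw [pow_add]
  exact Submodule.mul_mem_mul ha hb

theorem pow_mem_genSpan_pow {a : R} (ha : a ∈ genSpan K D I H) (n : ℕ) :
    a ^ n ∈ genSpan K D I H ^ n :=
  Submodule.pow_mem_pow _ ha n

theorem aeval_H_mem_genSpan_pow (p : K[X]) : aeval H p ∈ genSpan K D I H ^ p.natDegree := by
  rw [aeval_eq_sum_range]
  refine Submodule.sum_mem _ fun i hi => Submodule.smul_mem _ _ ?_
  exact mem_genSpan_pow_of_le (Nat.lt_succ_iff.1 (Finset.mem_range.1 hi))
    (pow_mem_genSpan_pow H_mem_genSpan i)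

theorem finiteDimensional_genSpan_pow (n : ℕ) :
    FiniteDimensional K (genSpan K D I H ^ n : Submodule K R) := by
  refine Module.Finite.iff_fg.2 ?_
  exact Submodule.FG.pow (Submodule.fg_span (Set.toFinite _)) n

end genSpan

namespace IsIntegroDiffGen

variable {K R : Type*} [Field K] [Ring R] [Algebra K R] {D I H P : R}

theorem exists_mem_genSpan_pow (h : IsIntegroDiffGen K D I H P) (a : R) :
    ∃ n, a ∈ genSpan K D I H ^ n := by
  have ha : a ∈ Algebra.adjoin K {D, I, H} := by rw [h.adjoin_eq_top]; trivial
  induction ha using Algebra.adjoin_induction with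
  | mem x hx =>
    refine ⟨1, ?_⟩
    rw [pow_one]
    exact Submodule.subset_span (Set.mem_insert_of_mem _ hx)
  | algebraMap r =>
    refine ⟨0, ?_⟩
    rw [pow_zero]
    exact Submodule.algebraMap_mem r
  | add x y _ _ hx hy =>
    obtain ⟨m, hm⟩ := hx
    obtain ⟨n, hn⟩ := hy
    exact ⟨max m n, Submodule.add_mem _ (mem_genSpan_pow_of_le (le_max_left _ _) hm)
      (mem_genSpan_pow_of_le (le_max_right _ _) hn)⟩
  | mul x y _ _ hx hy =>
    obtain ⟨m, hm⟩ := hx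
    obtain ⟨n, hn⟩ := hy
    exact ⟨m + n, mul_mem_genSpan_pow hm hn⟩

theorem op (h : IsIntegroDiffGen K D I H P) :
    IsIntegroDiffGen K (MulOpposite.op I) (MulOpposite.op D) (MulOpposite.op H)
      (MulOpposite.op P) where
  D_mul_I := by rw [← MulOpposite.op_mul, h.D_mul_I, MulOpposite.op_one]
  I_mul_D := by rw [← MulOpposite.op_mul, h.I_mul_D, MulOpposite.op_sub, MulOpposite.op_one]
  H_mul_I := by
    rw [← MulOpposite.op_mul, h.D_mul_H, MulOpposite.op_mul, MulOpposite.op_add,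
      MulOpposite.op_one]
  D_mul_H := by
    rw [← MulOpposite.op_mul, h.H_mul_I, MulOpposite.op_mul, MulOpposite.op_add,
      MulOpposite.op_one]
  H_mul_P := by rw [← MulOpposite.op_mul, h.P_mul_H]
  P_mul_H := by rw [← MulOpposite.op_mul, h.H_mul_P]
  P_ne_zero := by simpa using h.P_ne_zero
  adjoin_eq_top := by
    rw [eq_top_iff]
    rintro a -
    have ha : a.unop ∈ Algebra.adjoin K {D, I, H} := by rw [h.adjoin_eq_top]; trivial
    rw [← MulOpposite.op_unop a]
    generalize a.unop = b at ha
    induction ha using Algebra.adjoin_induction with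
    | mem x hx =>
      refine Algebra.subset_adjoin ?_
      rcases hx with rfl | rfl | rfl <;> simp
    | algebraMap r => exact Subalgebra.algebraMap_mem _ r
    | add x y _ _ hx hy => exact Subalgebra.add_mem _ hx hy
    | mul x y _ _ hx hy => exact Subalgebra.mul_mem _ hy hx

theorem D_mul_P (h : IsIntegroDiffGen K D I H P) : D * P = 0 := by
  have : P = 1 - I * D := by rw [h.I_mul_D, sub_sub_cancel]
  rw [this, mul_sub, mul_one, ← mul_assoc, h.D_mul_I, one_mul, sub_self]

theorem P_mul_I (h : IsIntegroDiffGen K D I H P) : P * I = 0 := by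
  have : P = 1 - I * D := by rw [h.I_mul_D, sub_sub_cancel]
  rw [this, sub_mul, one_mul, mul_assoc, h.D_mul_I, mul_one, sub_self]

theorem P_mul_I_pow (h : IsIntegroDiffGen K D I H P) {n : ℕ} (hn : 0 < n) : P * I ^ n = 0 := by
  obtain ⟨n, rfl⟩ := Nat.exists_eq_succ_of_ne_zero hn.ne'
  rw [pow_succ', ← mul_assoc, h.P_mul_I, zero_mul]

theorem D_pow_mul_I_pow (h : IsIntegroDiffGen K D I H P) (n : ℕ) : D ^ n * I ^ n = 1 := by
  induction n with
  | zero => simp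
  | succ n ih =>
    rw [pow_succ, pow_succ', mul_assoc, ← mul_assoc D, h.D_mul_I, one_mul, ih]

theorem D_pow_mul_I_pow_add (h : IsIntegroDiffGen K D I H P) (n k : ℕ) :
    D ^ n * I ^ (n + k) = I ^ k := by
  rw [pow_add, ← mul_assoc, h.D_pow_mul_I_pow, one_mul]

theorem D_pow_mul_H (h : IsIntegroDiffGen K D I H P) (n : ℕ) :
    D ^ n * H = (H + algebraMap K R n) * D ^ n := by
  induction n with
  | zero => simp
  | succ n ih =>
    rw [pow_succ, mul_assoc, h.D_mul_H, ← mul_assoc, mul_add, ih]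
    push_cast
    noncomm_ring

theorem D_pow_mul_aeval (h : IsIntegroDiffGen K D I H P) (n : ℕ) (p : K[X]) :
    D ^ n * aeval H p = aeval H (p.comp (X + C (n : K))) * D ^ n := by
  rw [mul_aeval_of_mul_eq (h.D_pow_mul_H n), aeval_comp]
  simp

theorem I_pow_mul_H (h : IsIntegroDiffGen K D I H P) (n : ℕ) :
    I ^ n * H = (H - algebraMap K R n) * I ^ n := by
  induction n with
  | zero => simp
  | succ n ih =>
    have : I * H = (H - 1) * I := by
      rw [sub_mul, h.H_mul_I]; noncomm_ring
    rw [pow_succ, mul_assoc, this, ← mul_assoc, mul_sub, ih]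
    push_cast
    noncomm_ring

theorem I_pow_mul_aeval (h : IsIntegroDiffGen K D I H P) (n : ℕ) (p : K[X]) :
    I ^ n * aeval H p = aeval H (p.comp (X + C (-n : K))) * I ^ n := by
  rw [mul_aeval_of_mul_eq (h.I_pow_mul_H n), aeval_comp]
  simp [sub_eq_add_neg]

theorem aeval_mul_I_pow (h : IsIntegroDiffGen K D I H P) (n : ℕ) (p : K[X]) :
    aeval H p * I ^ n = I ^ n * aeval H (p.comp (X + C (n : K))) := by
  rw [h.I_pow_mul_aeval, comp_assoc]
  simp

theorem P_mul_aeval (h : IsIntegroDiffGen K D I H P) (p : K[X]) :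
    P * aeval H p = p.eval 1 • P := by
  have : P * H = algebraMap K R 1 * P := by rw [h.P_mul_H, map_one, one_mul]
  rw [mul_aeval_of_mul_eq this, aeval_algebraMap_apply, Algebra.smul_def]
  simp

/-! ### At least linear growth of every nonzero module -/

section LowerBound

variable {N : Type*} [AddCommGroup N] [Module R N]

/-- Irreducible factors of `q` are stripped one at a time; the last nonzero vector before reaching
zero is killed by a single irreducible factor. -/
theorem exists_irreducible_annihilator {v : N} (hv : v ≠ 0) {q : K[X]} (hq : q ≠ 0)
    (hqv : aeval H q • v = 0) :
    ∃ r q' : K[X], Irreducible q' ∧ aeval H r • v ≠ 0 ∧ aeval H q' • aeval H r • v = 0 := by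
  induction q using WfDvdMonoid.induction_on_irreducible with
  | zero => exact absurd rfl hq
  | unit u hu =>
    obtain ⟨c, hc, rfl⟩ := Polynomial.isUnit_iff.1 hu
    refine absurd ?_ hv
    rw [aeval_C] at hqv
    have : algebraMap K R c⁻¹ • algebraMap K R c • v = 0 := by rw [hqv, smul_zero]
    rwa [smul_smul, ← map_mul, inv_mul_cancel₀ hc.ne_zero, map_one, one_smul] at this
  | mul a i ha hi ih =>
    by_cases hav : aeval H a • v = 0
    · exact ih ha hav
    · refine ⟨a, i, hi, hav, ?_⟩
      rwa [smul_smul, ← map_mul]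

variable [Module K N] [IsScalarTower K R N]

/-- The vector `I ^ l • v` is killed by the translate `q(H - l)`. Distinct translates are coprime,
so these vectors lie in different primary components for `H`, and they are nonzero because `D ^ l *
I ^ l = 1`. -/
theorem linearIndependent_I_pow_smul [CharZero K] (h : IsIntegroDiffGen K D I H P) {v : N}
    (hv : v ≠ 0) {q : K[X]} (hq : Irreducible q) (hqv : aeval H q • v = 0) (n : ℕ) :
    LinearIndependent K fun l : Fin n => I ^ (l : ℕ) • v := by
  rw [Fintype.linearIndependent_iff]
  intro g hg i
  set Q : Fin n → K[X] := fun l => q.comp (X + C (-((l : ℕ) : K))) with hQ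
  have hann : ∀ l : Fin n, aeval H (Q l) • I ^ (l : ℕ) • v = 0 := fun l => by
    rw [smul_smul, hQ, ← h.I_pow_mul_aeval, mul_smul, hqv, smul_zero]
  have hcop : IsCoprime (∏ l ∈ Finset.univ.erase i, Q l) (Q i) := by
    refine IsCoprime.prod_left fun l hl => isCoprime_comp_X_add_C hq ?_
    rw [Ne, neg_inj, Nat.cast_inj, ← Fin.ext_iff]
    exact Finset.ne_of_mem_erase hl
  -- By Bézout, `s` times the product of the other translates acts as the identity on the `i`-th
  -- vector and kills all the others.
  obtain ⟨s, t, hst⟩ := hcop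
  have hsum := congrArg (fun w => aeval H (s * ∏ l ∈ Finset.univ.erase i, Q l) • w) hg
  simp only [smul_zero, Finset.smul_sum] at hsum
  rw [Finset.sum_eq_single i] at hsum
  · have hone : aeval H (s * ∏ l ∈ Finset.univ.erase i, Q l) • g i • I ^ (i : ℕ) • v =
        g i • I ^ (i : ℕ) • v := by
      have : s * ∏ l ∈ Finset.univ.erase i, Q l = 1 - t * Q i := by rw [← hst]; ring
      rw [this, smul_comm, map_sub, map_one, map_mul, sub_smul, mul_smul, hann, smul_zero,
        one_smul, sub_zero]
    rw [hone] at hsum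
    refine (smul_eq_zero.1 hsum).resolve_right fun h0 => hv ?_
    have := congrArg (fun w => D ^ (i : ℕ) • w) h0
    simpa [smul_smul, h.D_pow_mul_I_pow] using this
  · intro l _ hl
    rw [smul_comm, ← Finset.mul_prod_erase _ Q (Finset.mem_erase.2 ⟨hl, Finset.mem_univ l⟩),
      mul_left_comm, mul_comm (Q l), map_mul, mul_smul, hann, smul_zero, smul_zero]
  · simp

/-- Either `v` is free over `K[H]` and the powers of `H` serve, or some `aeval H r • v` is killed by
an irreducible polynomial and the powers of `I` applied to it serve. The shift `c` is the degree of
`r`, independent of `n`. -/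
theorem exists_linearIndependent_smul [CharZero K] (h : IsIntegroDiffGen K D I H P) {v : N}
    (hv : v ≠ 0) : ∃ c, ∀ n, ∃ w : Fin n → R,
      (∀ l, w l ∈ genSpan K D I H ^ (n + c)) ∧ LinearIndependent K fun l => w l • v := by
  by_cases hinj : ∀ q : K[X], aeval H q • v = 0 → q = 0
  · refine ⟨0, fun n => ⟨fun l => H ^ (l : ℕ), fun l => ?_, ?_⟩⟩
    · exact mem_genSpan_pow_of_le (by omega) (pow_mem_genSpan_pow H_mem_genSpan _)
    · rw [Fintype.linearIndependent_iff]
      intro g hg i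
      have := hinj (∑ l : Fin n, C (g l) * X ^ (l : ℕ)) (by
        simpa [Finset.sum_smul, map_sum, mul_smul] using hg)
      have := congrArg (fun p => coeff p (i : ℕ)) this
      simpa [finsetSum_coeff, coeff_C_mul, coeff_X_pow, Fin.val_inj] using this
  · push Not at hinj
    obtain ⟨q, hqv, hq⟩ := hinj
    obtain ⟨r, q', hq', hr, hq'r⟩ := exists_irreducible_annihilator hv hq hqv
    refine ⟨r.natDegree, fun n => ⟨fun l => I ^ (l : ℕ) * aeval H r, fun l => ?_, ?_⟩⟩
    · exact mem_genSpan_pow_of_le (by omega)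
        (mul_mem_genSpan_pow (pow_mem_genSpan_pow I_mem_genSpan _) (aeval_H_mem_genSpan_pow r))
    · simpa only [mul_smul] using h.linearIndependent_I_pow_smul hr hq' hq'r n

end LowerBound

end IsIntegroDiffGen

/-! ### Linear growth implies finite length -/

/-- An increasing exhaustive filtration of a module by finite-dimensional subspaces of at most
linearly growing dimension, compatible with the powers of the span of the generators. -/
structure IsLinearFiltration (K : Type*) {R M : Type*} [Field K] [Ring R] [Algebra K R]
    (D I H : R) [AddCommGroup M] [Module R M] [Module K M]
    (fil : ℕ → Submodule K M) (c b : ℕ) : Prop where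
  exhaustive : ∀ x, ∃ n, x ∈ fil n
  smul_mem : ∀ {k n : ℕ} {w : R} {x : M}, w ∈ genSpan K D I H ^ k → x ∈ fil n →
    w • x ∈ fil (k + n)
  finiteDimensional : ∀ n, FiniteDimensional K (fil n)
  finrank_le : ∀ n, Module.finrank K (fil n) ≤ c * n + b

namespace IsLinearFiltration

variable {K R M : Type*} [Field K] [Ring R] [Algebra K R] {D I H P : R}
  [AddCommGroup M] [Module R M] [Module K M] {fil : ℕ → Submodule K M} {c b : ℕ}

theorem mem_of_le (hf : IsLinearFiltration K D I H fil c b) {m n : ℕ} (hmn : m ≤ n) {x : M}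
    (hx : x ∈ fil m) : x ∈ fil n := by
  have : (1 : R) ∈ genSpan K D I H ^ (n - m) :=
    mem_genSpan_pow_of_le (Nat.zero_le _) (by rw [pow_zero]; exact Submodule.one_le.1 le_rfl)
  simpa [Nat.sub_add_cancel hmn] using hf.smul_mem this hx

variable [IsScalarTower K R M]

/-- The lower bound is applied to the class in `M ⧸ p` of a vector of `q` outside `p`. The offset
`e` absorbs the filtration level of that vector and the shift of the lower bound. -/
theorem finrank_inf_add_le [CharZero K] (h : IsIntegroDiffGen K D I H P)
    (hf : IsLinearFiltration K D I H fil c b) {p q : Submodule R M} (hpq : p < q) :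
    ∃ e, ∀ n, e ≤ n →
      Module.finrank K ↥(fil n ⊓ p.restrictScalars K) + (n - e) ≤
        Module.finrank K ↥(fil n ⊓ q.restrictScalars K) := by
  obtain ⟨v, hvq, hvp⟩ := SetLike.exists_of_lt hpq
  obtain ⟨n₀, hn₀⟩ := hf.exhaustive v
  have hv : p.mkQ v ≠ 0 := by simpa using hvp
  obtain ⟨d, hd⟩ := h.exists_linearIndependent_smul hv
  refine ⟨n₀ + d, fun n hn => ?_⟩
  obtain ⟨w, hw, hli⟩ := hd (n - (n₀ + d))
  have := hf.finiteDimensional n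
  set A : Submodule K M := fil n ⊓ q.restrictScalars K with hA
  have : FiniteDimensional K A := Submodule.finiteDimensional_inf_left _ _
  let f : A →ₗ[K] M ⧸ p := (p.mkQ.restrictScalars K).comp A.subtype
  have hker : Module.finrank K ↥(fil n ⊓ p.restrictScalars K) ≤ Module.finrank K (LinearMap.ker f) := by
    have hle : fil n ⊓ p.restrictScalars K ≤ A :=
      inf_le_inf_left _ fun x hx => hpq.le hx
    let g : ↥(fil n ⊓ p.restrictScalars K) →ₗ[K] LinearMap.ker f :=
      (Submodule.inclusion hle).codRestrict _ fun x => by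
        have : (x : M) ∈ p := x.2.2
        simpa [f] using this
    refine LinearMap.finrank_le_finrank_of_injective (f := g) fun x y hxy => ?_
    exact Subtype.ext (congrArg (fun z : LinearMap.ker f => ((z : A) : M)) hxy)
  have hrange : n - (n₀ + d) ≤ Module.finrank K (LinearMap.range f) := by
    let y : Fin (n - (n₀ + d)) → LinearMap.range f := fun l =>
      ⟨w l • p.mkQ v, ⟨⟨w l • v, by
        refine ⟨?_, q.smul_mem _ hvq⟩
        exact hf.mem_of_le (by omega) (hf.smul_mem (hw l) hn₀)⟩, by simp [f]⟩⟩
    have hy : LinearIndependent K y :=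
      LinearIndependent.of_comp (LinearMap.range f).subtype hli
    simpa using hy.fintype_card_le_finrank
  have := LinearMap.finrank_range_add_finrank_ker f
  omega

theorem length_lt_top [CharZero K] (h : IsIntegroDiffGen K D I H P)
    (hf : IsLinearFiltration K D I H fil c b) : Module.length R M < ⊤ := by
  suffices hle : ∀ p : LTSeries (Submodule R M), p.length ≤ c by
    have : Order.krullDim (Submodule R M) ≤ c := iSup_le fun p => by exact_mod_cast hle p
    rw [← Module.coe_length] at this
    have h2 : Module.length R M ≤ c := by exact_mod_cast this
    exact lt_of_le_of_lt h2 (ENat.natCast_lt_top c)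
  intro p
  have key : ∀ i : Fin (p.length + 1), ∃ e, ∀ n, e ≤ n →
      i * (n - e) ≤ Module.finrank K ↥(fil n ⊓ (p i).restrictScalars K) := by
    intro i
    induction i using Fin.induction with
    | zero => exact ⟨0, by simp⟩
    | succ i ih =>
      obtain ⟨e₁, he₁⟩ := ih
      obtain ⟨e₂, he₂⟩ := hf.finrank_inf_add_le h (p.step i)
      refine ⟨max e₁ e₂, fun n hn => ?_⟩
      have h1 := he₁ n (le_trans (le_max_left _ _) hn)
      have h2 := he₂ n (le_trans (le_max_right _ _) hn)
      have h3 : (i : ℕ) * (n - max e₁ e₂) ≤ i * (n - e₁) := Nat.mul_le_mul_left _ (by omega)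
      simp only [Fin.val_castSucc] at h1
      rw [Fin.val_succ, add_mul, one_mul]
      refine le_trans (add_le_add (h3.trans h1) ?_) h2
      omega
  obtain ⟨e, he⟩ := key (Fin.last _)
  by_contra! hlt
  -- This level is the first at which `(c + 1) * (n - e)` exceeds `c * n + b`.
  have h1 := he (e + (c * e + b + 1)) (by omega)
  have := hf.finiteDimensional (e + (c * e + b + 1))
  have h2 := (Submodule.finrank_mono (inf_le_left (a := fil (e + (c * e + b + 1)))
    (b := (p (Fin.last _)).restrictScalars K))).trans (hf.finrank_le _)
  have h3 : (c + 1) * (c * e + b + 1) ≤ p.length * (c * e + b + 1) :=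
    Nat.mul_le_mul_right _ hlt
  simp only [Fin.val_last, Nat.add_sub_cancel_left] at h1
  nlinarith

end IsLinearFiltration

theorem mul_mem_of_mem_genSpan {K R : Type*} [Field K] [Ring R] [Algebra K R] {D I H : R}
    {S : Submodule K R} {x : R} (h1 : x ∈ S) (hD : D * x ∈ S) (hI : I * x ∈ S) (hH : H * x ∈ S)
    {g : R} (hg : g ∈ genSpan K D I H) : g * x ∈ S := by
  have : genSpan K D I H ≤ S.comap (LinearMap.mulRight K x) := by
    refine Submodule.span_le.2 ?_
    rintro _ (rfl | rfl | rfl | rfl) <;> simpa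
  exact this hg

theorem mul_mem_of_mem_genSpan_right {K R : Type*} [Field K] [Ring R] [Algebra K R] {D I H : R}
    {S : Submodule K R} {x : R} (h1 : x ∈ S) (hD : x * D ∈ S) (hI : x * I ∈ S) (hH : x * H ∈ S)
    {g : R} (hg : g ∈ genSpan K D I H) : x * g ∈ S := by
  have : genSpan K D I H ≤ S.comap (LinearMap.mulLeft K x) := by
    refine Submodule.span_le.2 ?_
    rintro _ (rfl | rfl | rfl | rfl) <;> simpa
  exact this hg

theorem mul_mem_of_mem_span {K R : Type*} [Field K] [Ring R] [Algebra K R] {T : Set R}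
    {S : Submodule K R} {g : R} (h : ∀ x ∈ T, g * x ∈ S) {x : R} (hx : x ∈ Submodule.span K T) :
    g * x ∈ S := by
  have : Submodule.span K T ≤ S.comap (LinearMap.mulLeft K g) := Submodule.span_le.2 h
  exact this hx

theorem mul_mem_of_mem_span_right {K R : Type*} [Field K] [Ring R] [Algebra K R] {T : Set R}
    {S : Submodule K R} {g : R} (h : ∀ x ∈ T, x * g ∈ S) {x : R} (hx : x ∈ Submodule.span K T) :
    x * g ∈ S := by
  have : Submodule.span K T ≤ S.comap (LinearMap.mulRight K g) := Submodule.span_le.2 h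
  exact this hx

/-! ### Annihilation by powers of `D` and `I`, and the span of the `I ^ i * P * D ^ j` -/

namespace IsIntegroDiffGen

variable {K R : Type*} [Field K] [Ring R] [Algebra K R] {D I H P : R}

theorem H_mul_I_pow (h : IsIntegroDiffGen K D I H P) (n : ℕ) :
    H * I ^ n = I ^ n * H + (n : K) • I ^ n := by
  rw [h.I_pow_mul_H, sub_mul, ← Algebra.smul_def, sub_add_cancel]

theorem mul_P_mem_span (h : IsIntegroDiffGen K D I H P) {n : ℕ} {a : R}
    (ha : a ∈ genSpan K D I H ^ n) :
    a * P ∈ Submodule.span K {x | ∃ i ≤ n, x = I ^ i * P} := by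
  induction n generalizing a with
  | zero =>
    rw [pow_zero, Submodule.mem_one] at ha
    obtain ⟨c, rfl⟩ := ha
    rw [← Algebra.smul_def]
    exact Submodule.smul_mem _ _ (Submodule.subset_span ⟨0, le_rfl, by simp⟩)
  | succ n ih =>
    rw [pow_succ'] at ha
    induction ha using Submodule.mul_induction_on' with
    | mem_mul_mem g hg c hc =>
      rw [mul_assoc]
      refine mul_mem_of_mem_span ?_ (ih hc)
      rintro _ ⟨i, hi, rfl⟩
      have hmem : ∀ j ≤ n + 1, I ^ j * P ∈
          Submodule.span K {x | ∃ i ≤ n + 1, x = I ^ i * P} := fun j hj =>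
        Submodule.subset_span ⟨j, hj, rfl⟩
      refine mul_mem_of_mem_genSpan (hmem i (by omega)) ?_ ?_ ?_ hg
      · rcases i with _ | i
        · rw [pow_zero, one_mul, h.D_mul_P]
          exact Submodule.zero_mem _
        · rw [pow_succ', ← mul_assoc, ← mul_assoc, h.D_mul_I, one_mul]
          exact hmem i (by omega)
      · rw [← mul_assoc, ← pow_succ']
        exact hmem _ (by omega)
      · rw [← mul_assoc, h.H_mul_I_pow, add_mul, mul_assoc, h.H_mul_P, smul_mul_assoc]
        exact Submodule.add_mem _ (hmem i (by omega)) (Submodule.smul_mem _ _ (hmem i (by omega)))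
    | add x _ y _ hx hy => rw [add_mul]; exact Submodule.add_mem _ hx hy

theorem P_mul_mem_span (h : IsIntegroDiffGen K D I H P) {n : ℕ} {a : R}
    (ha : a ∈ genSpan K D I H ^ n) :
    P * a ∈ Submodule.span K {x | ∃ i ≤ n, x = P * D ^ i} := by
  induction n generalizing a with
  | zero =>
    rw [pow_zero, Submodule.mem_one] at ha
    obtain ⟨c, rfl⟩ := ha
    rw [← Algebra.commutes, ← Algebra.smul_def]
    exact Submodule.smul_mem _ _ (Submodule.subset_span ⟨0, le_rfl, by simp⟩)
  | succ n ih =>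
    rw [pow_succ] at ha
    induction ha using Submodule.mul_induction_on' with
    | mem_mul_mem c hc g hg =>
      rw [← mul_assoc]
      refine mul_mem_of_mem_span_right ?_ (ih hc)
      rintro _ ⟨i, hi, rfl⟩
      have hmem : ∀ j ≤ n + 1, P * D ^ j ∈
          Submodule.span K {x | ∃ i ≤ n + 1, x = P * D ^ i} := fun j hj =>
        Submodule.subset_span ⟨j, hj, rfl⟩
      refine mul_mem_of_mem_genSpan_right (hmem i (by omega)) ?_ ?_ ?_ hg
      · rw [mul_assoc, ← pow_succ]
        exact hmem _ (by omega)
      · rcases i with _ | i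
        · rw [pow_zero, mul_one, h.P_mul_I]
          exact Submodule.zero_mem _
        · rw [pow_succ, mul_assoc, mul_assoc, h.D_mul_I, mul_one]
          exact hmem i (by omega)
      · rw [mul_assoc, h.D_pow_mul_H, add_mul, mul_add, ← mul_assoc, h.P_mul_H,
          ← Algebra.smul_def, mul_smul_comm]
        exact Submodule.add_mem _ (hmem i (by omega)) (Submodule.smul_mem _ _ (hmem i (by omega)))
    | add x _ y _ hx hy => rw [mul_add]; exact Submodule.add_mem _ hx hy

/-- Telescoping: consecutive terms `I ^ i * D ^ i` differ by `I ^ i * P * D ^ i`. -/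
theorem one_sub_I_pow_mul_D_pow (h : IsIntegroDiffGen K D I H P) (n : ℕ) :
    1 - I ^ n * D ^ n = ∑ i ∈ Finset.range n, I ^ i * P * D ^ i := by
  induction n with
  | zero => simp
  | succ n ih =>
    have : I ^ (n + 1) * D ^ (n + 1) = I ^ n * (I * D) * D ^ n := by
      rw [pow_succ, pow_succ']; simp only [mul_assoc]
    rw [Finset.sum_range_succ, ← ih, this, h.I_mul_D]
    noncomm_ring

theorem eq_sum_of_D_pow_mul_eq_zero (h : IsIntegroDiffGen K D I H P) {a : R} {n : ℕ}
    (ha : D ^ n * a = 0) : a = ∑ i ∈ Finset.range n, I ^ i * (P * (D ^ i * a)) := by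
  have : (1 - I ^ n * D ^ n) * a = a := by rw [sub_mul, mul_assoc, ha, mul_zero, one_mul, sub_zero]
  rw [h.one_sub_I_pow_mul_D_pow, Finset.sum_mul] at this
  simpa only [mul_assoc] using this.symm

theorem eq_sum_of_mul_I_pow_eq_zero (h : IsIntegroDiffGen K D I H P) {a : R} {n : ℕ}
    (ha : a * I ^ n = 0) : a = ∑ i ∈ Finset.range n, (a * I ^ i * P) * D ^ i := by
  have : a * (1 - I ^ n * D ^ n) = a := by
    rw [mul_sub, ← mul_assoc, ha, zero_mul, mul_one, sub_zero]
  rw [h.one_sub_I_pow_mul_D_pow, Finset.mul_sum] at this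
  simpa only [mul_assoc] using this.symm

/-- If `D ^ n * a = 0` then `a` is a sum of terms `I ^ i * (P * (D ^ i * a))`, and each `P * (D ^ i
* a)` is a combination of `P * D ^ j` with `j` bounded. A larger power of `I` kills these since `P *
I = 0`. The converse is the mirror image, with `D * P = 0`. -/
theorem exists_D_pow_mul_eq_zero_iff (h : IsIntegroDiffGen K D I H P) (a : R) :
    (∃ n, D ^ n * a = 0) ↔ ∃ n, a * I ^ n = 0 := by
  obtain ⟨k, hk⟩ := h.exists_mem_genSpan_pow a
  constructor
  · rintro ⟨n, hn⟩
    refine ⟨k + n + 1, ?_⟩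
    rw [h.eq_sum_of_D_pow_mul_eq_zero hn, Finset.sum_mul]
    refine Finset.sum_eq_zero fun i hi => ?_
    have hmem := h.P_mul_mem_span (mul_mem_genSpan_pow (pow_mem_genSpan_pow D_mem_genSpan i) hk)
    rw [mul_assoc, ← Submodule.mem_bot (R := K)]
    -- The factor `I ^ i` is dropped: it suffices that the remaining factor lies in the zero space,
    -- written as the span of `{0}`.
    refine mul_mem_of_mem_span (S := ⊥) (g := I ^ i) (T := {0}) (by simp) ?_
    rw [Submodule.span_singleton_eq_bot.2 rfl]
    refine mul_mem_of_mem_span_right ?_ hmem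
    rintro _ ⟨j, hj, rfl⟩
    obtain ⟨r, hr⟩ : ∃ r, k + n + 1 = j + (r + 1) :=
      ⟨k + n - j, by have := Finset.mem_range.1 hi; omega⟩
    rw [mul_assoc, hr, h.D_pow_mul_I_pow_add, h.P_mul_I_pow (Nat.succ_pos _)]
    exact Submodule.zero_mem _
  · rintro ⟨n, hn⟩
    refine ⟨k + n + 1, ?_⟩
    rw [h.eq_sum_of_mul_I_pow_eq_zero hn, Finset.mul_sum]
    refine Finset.sum_eq_zero fun i hi => ?_
    have hmem := h.mul_P_mem_span (mul_mem_genSpan_pow hk (pow_mem_genSpan_pow I_mem_genSpan i))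
    have hz : D ^ (k + n + 1) * (a * I ^ i * P) ∈ (⊥ : Submodule K R) := by
      refine mul_mem_of_mem_span ?_ hmem
      rintro _ ⟨j, hj, rfl⟩
      obtain ⟨r, hr⟩ : ∃ r, k + n + 1 = (r + 1) + j :=
        ⟨k + n - j, by have := Finset.mem_range.1 hi; omega⟩
      rw [hr, pow_add, ← mul_assoc, mul_assoc (D ^ (r + 1)), h.D_pow_mul_I_pow, mul_one, pow_succ,
        mul_assoc, h.D_mul_P, mul_zero]
      exact Submodule.zero_mem _
    rw [← mul_assoc, (Submodule.mem_bot K).1 hz, zero_mul]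

theorem exists_D_pow_mul_eq_zero_iff_mem_span (h : IsIntegroDiffGen K D I H P) (a : R) :
    (∃ n, D ^ n * a = 0) ↔ a ∈ Submodule.span K {x | ∃ i j, x = I ^ i * P * D ^ j} := by
  constructor
  · rintro ⟨n, hn⟩
    obtain ⟨k, hk⟩ := h.exists_mem_genSpan_pow a
    rw [h.eq_sum_of_D_pow_mul_eq_zero hn]
    refine Submodule.sum_mem _ fun i _ => ?_
    refine mul_mem_of_mem_span ?_ (h.P_mul_mem_span
      (mul_mem_genSpan_pow (pow_mem_genSpan_pow D_mem_genSpan i) hk))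
    rintro _ ⟨j, _, rfl⟩
    exact Submodule.subset_span ⟨i, j, (mul_assoc _ _ _).symm⟩
  · intro ha
    induction ha using Submodule.span_induction with
    | mem x hx =>
      obtain ⟨i, j, rfl⟩ := hx
      refine ⟨i + 1, ?_⟩
      rw [pow_succ', ← mul_assoc, ← mul_assoc, mul_assoc D, h.D_pow_mul_I_pow, mul_one, h.D_mul_P,
        zero_mul]
    | zero => exact ⟨0, by simp⟩
    | add x y _ _ hx hy =>
      obtain ⟨m, hm⟩ := hx
      obtain ⟨n, hn⟩ := hy
      refine ⟨m + n, ?_⟩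
      rw [mul_add, pow_add, mul_assoc _ _ y, hn, mul_zero, add_zero, ← pow_add, add_comm, pow_add,
        mul_assoc, hm, mul_zero]
    | smul c x _ hx =>
      obtain ⟨n, hn⟩ := hx
      exact ⟨n, by rw [mul_smul_comm, hn, smul_zero]⟩

/-! ### Growth of the algebra is at most quadratic -/

section Growth

/-- The words that span the quotient of consecutive powers of the span of the generators. -/
def normalWords (D I H : R) (m : ℕ) : Set R :=
  {x | ∃ i k, i + k = m ∧ (x = I ^ i * H ^ k ∨ x = H ^ i * D ^ k ∨ x = I ^ i * D ^ k)}

theorem D_mul_H_pow_sub_mem (h : IsIntegroDiffGen K D I H P) (n : ℕ) :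
    D * H ^ n - H ^ n * D ∈ genSpan K D I H ^ n := by
  induction n with
  | zero => simp
  | succ n ih =>
    have : D * H ^ (n + 1) - H ^ (n + 1) * D = (D * H ^ n - H ^ n * D) * H + H ^ n * D := by
      have h1 : H ^ n * (D * H) = H ^ n * ((H + 1) * D) := by rw [h.D_mul_H]
      rw [pow_succ, ← mul_assoc, sub_mul, mul_assoc (H ^ n) D H, h1]
      noncomm_ring
    rw [this]
    refine Submodule.add_mem _ ?_ ?_
    · rw [pow_succ]; exact Submodule.mul_mem_mul ih H_mem_genSpan
    · rw [pow_succ]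
      exact Submodule.mul_mem_mul (pow_mem_genSpan_pow H_mem_genSpan n) D_mem_genSpan

/-- Moving `I` to the right turns `H` into `H - 1`, and `H - 1` kills the `P` in `I * D = 1 - P`. At
least one factor `H` is needed. Words containing all three generators therefore drop in degree. -/
theorem I_mul_H_pow_succ_mul_D (h : IsIntegroDiffGen K D I H P) (n : ℕ) :
    I * H ^ (n + 1) * D = (H - 1) ^ (n + 1) := by
  have h1 : SemiconjBy I H (H - 1) := by
    have := h.I_pow_mul_H 1
    change I * H = (H - 1) * I
    simpa using this
  have h2 : I * H ^ (n + 1) = (H - 1) ^ (n + 1) * I := h1.pow_right _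
  have h3 : (H - 1) ^ (n + 1) * P = 0 := by
    rw [pow_succ, mul_assoc, sub_mul, h.H_mul_P, one_mul, sub_self, mul_zero]
  rw [h2, mul_assoc, h.I_mul_D, mul_sub, h3, mul_one, sub_zero]

theorem H_mul_I_pow_mul_D_pow (h : IsIntegroDiffGen K D I H P) (i k : ℕ) :
    H * (I ^ (i + 1) * D ^ (k + 1)) =
      I ^ i * H * D ^ k - I ^ i * D ^ k + ((i : K) + 1) • (I ^ (i + 1) * D ^ (k + 1)) := by
  have h1 : I * H * D = H - 1 := by simpa using h.I_mul_H_pow_succ_mul_D 0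
  have h2 : I ^ (i + 1) * H * D ^ (k + 1) = I ^ i * (I * H * D) * D ^ k := by
    rw [pow_succ, pow_succ']; simp only [mul_assoc]
  rw [← mul_assoc, h.H_mul_I_pow, add_mul, h2, h1, smul_mul_assoc]
  push_cast
  congr 1
  noncomm_ring

/-- Modulo lower degree the generators commute up to `D * I = 0` and `I * H * D = 0`, so a generator
times a normal word is either a normal word or of lower degree. The three families of normal words
are those in which at most two kinds of letters meet. -/
theorem mul_mem_of_mem_normalWords (h : IsIntegroDiffGen K D I H P) {m : ℕ} {g x : R}
    (hg : g ∈ genSpan K D I H) (hx : x ∈ normalWords D I H m) :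
    g * x ∈ genSpan K D I H ^ m ⊔ Submodule.span K (normalWords D I H (m + 1)) := by
  have hI := fun n => pow_mem_genSpan_pow (K := K) (I_mem_genSpan (D := D) (I := I) (H := H)) n
  have hD := fun n => pow_mem_genSpan_pow (K := K) (D_mem_genSpan (D := D) (I := I) (H := H)) n
  have hH := fun n => pow_mem_genSpan_pow (K := K) (H_mem_genSpan (D := D) (I := I) (H := H)) n
  have low : ∀ {n : ℕ} {y : R}, n ≤ m → y ∈ genSpan K D I H ^ n →
      y ∈ genSpan K D I H ^ m ⊔ Submodule.span K (normalWords D I H (m + 1)) :=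
    fun hn hy => Submodule.mem_sup_left (mem_genSpan_pow_of_le hn hy)
  have top : ∀ {y : R}, y ∈ normalWords D I H (m + 1) →
      y ∈ genSpan K D I H ^ m ⊔ Submodule.span K (normalWords D I H (m + 1)) :=
    fun hy => Submodule.mem_sup_right (Submodule.subset_span hy)
  obtain ⟨i, k, rfl, rfl | rfl | rfl⟩ := hx
  · refine mul_mem_of_mem_genSpan (low le_rfl (mul_mem_genSpan_pow (hI i) (hH k))) ?_ ?_ ?_ hg
    · rcases i with _ | i
      · have : D * (I ^ 0 * H ^ k) = (D * H ^ k - H ^ k * D) + H ^ k * D ^ 1 := by simp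
        rw [this]
        exact Submodule.add_mem _ (low (by omega) (h.D_mul_H_pow_sub_mem k))
          (top ⟨k, 1, by omega, Or.inr (Or.inl rfl)⟩)
      · rw [pow_succ', mul_assoc, ← mul_assoc, h.D_mul_I, one_mul]
        exact low (by omega) (mul_mem_genSpan_pow (hI i) (hH k))
    · rw [← mul_assoc, ← pow_succ']
      exact top ⟨i + 1, k, by omega, Or.inl rfl⟩
    · rw [← mul_assoc, h.H_mul_I_pow, add_mul, mul_assoc, ← pow_succ', smul_mul_assoc]
      exact Submodule.add_mem _ (top ⟨i, k + 1, by omega, Or.inl rfl⟩)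
        (Submodule.smul_mem _ _ (low le_rfl (mul_mem_genSpan_pow (hI i) (hH k))))
  · refine mul_mem_of_mem_genSpan (low le_rfl (mul_mem_genSpan_pow (hH i) (hD k))) ?_ ?_ ?_ hg
    · have : D * (H ^ i * D ^ k) = (D * H ^ i - H ^ i * D) * D ^ k + H ^ i * D ^ (k + 1) := by
        rw [sub_mul, pow_succ', mul_assoc, mul_assoc, sub_add_cancel]
      rw [this]
      exact Submodule.add_mem _
        (low le_rfl (mul_mem_genSpan_pow (h.D_mul_H_pow_sub_mem i) (hD k)))
        (top ⟨i, k + 1, by omega, Or.inr (Or.inl rfl)⟩)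
    · rcases k with _ | k
      · exact top ⟨1, i, by omega, Or.inl (by simp)⟩
      rcases i with _ | i
      · exact top ⟨1, k + 1, by omega, Or.inr (Or.inr (by simp))⟩
      have : I * (H ^ (i + 1) * D ^ (k + 1)) = (I * H ^ (i + 1) * D) * D ^ k := by
        rw [pow_succ' D]; simp only [mul_assoc]
      rw [this, h.I_mul_H_pow_succ_mul_D]
      refine low (n := i + 1 + k) (by omega) (mul_mem_genSpan_pow ?_ (hD k))
      exact pow_mem_genSpan_pow (Submodule.sub_mem _ H_mem_genSpan one_mem_genSpan) _
    · rw [← mul_assoc, ← pow_succ']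
      exact top ⟨i + 1, k, by omega, Or.inr (Or.inl rfl)⟩
  · refine mul_mem_of_mem_genSpan (low le_rfl (mul_mem_genSpan_pow (hI i) (hD k))) ?_ ?_ ?_ hg
    · rcases i with _ | i
      · exact top ⟨0, k + 1, by omega, Or.inr (Or.inl (by simp [pow_succ']))⟩
      · rw [pow_succ', mul_assoc, ← mul_assoc, h.D_mul_I, one_mul]
        exact low (by omega) (mul_mem_genSpan_pow (hI i) (hD k))
    · rw [← mul_assoc, ← pow_succ']
      exact top ⟨i + 1, k, by omega, Or.inr (Or.inr rfl)⟩
    · rcases i with _ | i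
      · exact top ⟨1, k, by omega, Or.inr (Or.inl (by simp))⟩
      rcases k with _ | k
      · rw [pow_zero, mul_one, h.H_mul_I_pow]
        exact Submodule.add_mem _ (top ⟨i + 1, 1, by omega, Or.inl (by simp)⟩)
          (Submodule.smul_mem _ _ (low (by omega) (hI (i + 1))))
      rw [h.H_mul_I_pow_mul_D_pow]
      refine Submodule.add_mem _ (Submodule.sub_mem _ ?_ ?_) (Submodule.smul_mem _ _ ?_)
      · exact low (n := i + 1 + k) (by omega)
          (mul_mem_genSpan_pow (by rw [pow_succ]; exact Submodule.mul_mem_mul (hI i) H_mem_genSpan)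
            (hD k))
      · exact low (n := i + k) (by omega) (mul_mem_genSpan_pow (hI i) (hD k))
      · exact low le_rfl (mul_mem_genSpan_pow (hI (i + 1)) (hD (k + 1)))

theorem genSpan_pow_succ_le (h : IsIntegroDiffGen K D I H P) (n : ℕ) :
    genSpan K D I H ^ (n + 1) ≤
      genSpan K D I H ^ n ⊔ Submodule.span K (normalWords D I H (n + 1)) := by
  induction n with
  | zero =>
    intro g hg
    have := h.mul_mem_of_mem_normalWords (m := 0) (g := g) (x := 1) (by simpa using hg)
      ⟨0, 0, rfl, Or.inl (by simp)⟩
    simpa using this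
  | succ n ih =>
    rw [pow_succ']
    refine Submodule.mul_le.2 fun g hg x hx => ?_
    obtain ⟨y, hy, z, hz, rfl⟩ := Submodule.mem_sup.1 (ih hx)
    rw [mul_add]
    refine Submodule.add_mem _ (Submodule.mem_sup_left ?_) ?_
    · rw [pow_succ']
      exact Submodule.mul_mem_mul hg hy
    · exact mul_mem_of_mem_span (fun x hx => h.mul_mem_of_mem_normalWords hg hx) hz

theorem finrank_genSpan_pow_succ_le (h : IsIntegroDiffGen K D I H P) (n : ℕ) :
    Module.finrank K ↥(genSpan K D I H ^ (n + 1)) ≤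
      Module.finrank K ↥(genSpan K D I H ^ n) + 3 * (n + 2) := by
  classical
  let T : Finset R := (Finset.range (n + 2)).image (fun i => I ^ i * H ^ (n + 1 - i)) ∪
    ((Finset.range (n + 2)).image (fun i => H ^ i * D ^ (n + 1 - i)) ∪
      (Finset.range (n + 2)).image (fun i => I ^ i * D ^ (n + 1 - i)))
  have hT : normalWords D I H (n + 1) ⊆ T := by
    rintro x ⟨i, k, hik, hx⟩
    have hk : k = n + 1 - i := by omega
    subst hk
    have hi : i ∈ Finset.range (n + 2) := Finset.mem_range.2 (by omega)
    simp only [T, Finset.coe_union, Set.mem_union, Finset.mem_coe, Finset.mem_image]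
    rcases hx with rfl | rfl | rfl
    · exact Or.inl ⟨i, hi, rfl⟩
    · exact Or.inr (Or.inl ⟨i, hi, rfl⟩)
    · exact Or.inr (Or.inr ⟨i, hi, rfl⟩)
  have hcard : T.card ≤ 3 * (n + 2) := by
    refine (Finset.card_union_le _ _).trans ?_
    have h1 := Finset.card_union_le
      ((Finset.range (n + 2)).image (fun i => H ^ i * D ^ (n + 1 - i)))
      ((Finset.range (n + 2)).image (fun i => I ^ i * D ^ (n + 1 - i)))
    have h2 : ∀ f : ℕ → R, ((Finset.range (n + 2)).image f).card ≤ n + 2 := fun f =>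
      Finset.card_image_le.trans (by simp)
    have h3 := h2 (fun i => I ^ i * H ^ (n + 1 - i))
    have h4 := h2 (fun i => H ^ i * D ^ (n + 1 - i))
    have h5 := h2 (fun i => I ^ i * D ^ (n + 1 - i))
    omega
  have := finiteDimensional_genSpan_pow (K := K) (D := D) (I := I) (H := H) n
  have hle := (h.genSpan_pow_succ_le n).trans (sup_le_sup_left (Submodule.span_mono hT) _)
  have hspan : Module.finrank K (Submodule.span K (T : Set R)) ≤ 3 * (n + 2) :=
    (finrank_span_finset_le_card T).trans hcard
  calc _ ≤ _ := Submodule.finrank_mono hle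
    _ ≤ _ := Submodule.finrank_add_le_finrank_add_finrank _ _
    _ ≤ _ := Nat.add_le_add_left hspan _

theorem finrank_genSpan_pow_add_le (h : IsIntegroDiffGen K D I H P) (n d : ℕ) :
    Module.finrank K ↥(genSpan K D I H ^ (n + d)) ≤
      Module.finrank K ↥(genSpan K D I H ^ n) + d * (3 * (n + d + 1)) := by
  induction d with
  | zero => simp
  | succ d ih =>
    have := h.finrank_genSpan_pow_succ_le (n + d)
    have h2 : d * (3 * (n + d + 1)) ≤ d * (3 * (n + (d + 1) + 1)) :=
      Nat.mul_le_mul_left _ (by omega)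
    rw [← add_assoc n d 1, add_mul d 1]
    rw [← add_assoc n d 1] at h2
    omega

end Growth

/-- An element `b` of the kernel is the sum over `j < J` of `(b * I ^ j * P) * D ^ j`, and `b * I ^
j * P` involves only `I ^ i * P` with `i ≤ n + j`. -/
theorem finrank_inf_ker_I_pow_le (h : IsIntegroDiffGen K D I H P) (n J : ℕ) :
    Module.finrank K ↥(genSpan K D I H ^ n ⊓
      (LinearMap.ker (rightMulMap (I ^ J))).restrictScalars K) ≤ J * (n + J + 1) := by
  classical
  let T : Finset R := (Finset.range J ×ˢ Finset.range (n + J + 1)).image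
    fun q => I ^ q.2 * P * D ^ q.1
  have hle : genSpan K D I H ^ n ⊓ (LinearMap.ker (rightMulMap (I ^ J))).restrictScalars K ≤
      Submodule.span K (T : Set R) := by
    rintro b ⟨hbn, hbJ⟩
    have hbJ : b * I ^ J = 0 := hbJ
    rw [h.eq_sum_of_mul_I_pow_eq_zero hbJ]
    refine Submodule.sum_mem _ fun j hj => ?_
    refine mul_mem_of_mem_span_right ?_
      (h.mul_P_mem_span (mul_mem_genSpan_pow hbn (pow_mem_genSpan_pow I_mem_genSpan j)))
    rintro _ ⟨i, hi, rfl⟩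
    refine Submodule.subset_span (Finset.mem_coe.2 (Finset.mem_image.2 ⟨(j, i), ?_, rfl⟩))
    rw [Finset.mem_product]
    exact ⟨hj, Finset.mem_range.2 (by have := Finset.mem_range.1 hj; omega)⟩
  calc _ ≤ _ := Submodule.finrank_mono hle
    _ ≤ _ := finrank_span_finset_le_card T
    _ ≤ _ := Finset.card_image_le
    _ = _ := by simp

end IsIntegroDiffGen

/-! ### Differential operators and their leading coefficients -/

/-- The differential operators of order less than `m`, with `H`-polynomial coefficients. -/
def orderLT (K : Type*) {R : Type*} [Field K] [Ring R] [Algebra K R] (D H : R) (m : ℕ) :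
    Submodule K R :=
  Submodule.span K {x | ∃ (p : K[X]) (j : ℕ), j < m ∧ x = aeval H p * D ^ j}

theorem aeval_mul_pow_mem_orderLT {K R : Type*} [Field K] [Ring R] [Algebra K R] {D H : R}
    (p : K[X]) {j m : ℕ} (hj : j < m) : aeval H p * D ^ j ∈ orderLT K D H m :=
  Submodule.subset_span ⟨p, j, hj, rfl⟩

theorem orderLT_mono {K R : Type*} [Field K] [Ring R] [Algebra K R] {D H : R} :
    Monotone (orderLT K D H) := fun _ _ hmn =>
  Submodule.span_mono fun _ ⟨p, j, hj, hx⟩ => ⟨p, j, hj.trans_le hmn, hx⟩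

/-- `u` is a differential operator of order at most `m` with coefficient `p` at `D ^ m`. -/
def HasLead {K R : Type*} [Field K] [Ring R] [Algebra K R] (D H : R) (m : ℕ) (p : K[X])
    (u : R) : Prop :=
  u - aeval H p * D ^ m ∈ orderLT K D H m

namespace IsIntegroDiffGen

variable {K R : Type*} [Field K] [Ring R] [Algebra K R] {D I H P : R}

theorem D_pow_mul_aeval_mul_D_pow (h : IsIntegroDiffGen K D I H P) (n j : ℕ) (p : K[X]) :
    D ^ n * (aeval H p * D ^ j) = aeval H (p.comp (X + C (n : K))) * D ^ (n + j) := by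
  rw [← mul_assoc, h.D_pow_mul_aeval, mul_assoc, ← pow_add]

theorem D_mul_aeval_mul_D_pow (h : IsIntegroDiffGen K D I H P) (j : ℕ) (p : K[X]) :
    D * (aeval H p * D ^ j) = aeval H (p.comp (X + C (1 : K))) * D ^ (j + 1) := by
  have := h.D_pow_mul_aeval_mul_D_pow 1 j p
  rwa [pow_one, Nat.cast_one, add_comm 1 j] at this

theorem D_mul_mem_orderLT (h : IsIntegroDiffGen K D I H P) {m : ℕ} {u : R}
    (hu : u ∈ orderLT K D H m) : D * u ∈ orderLT K D H (m + 1) := by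
  refine mul_mem_of_mem_span ?_ hu
  rintro _ ⟨p, j, hj, rfl⟩
  rw [h.D_mul_aeval_mul_D_pow]
  exact aeval_mul_pow_mem_orderLT _ (by omega)

theorem mul_mem_orderLT_of_mem_genSpan (h : IsIntegroDiffGen K D I H P) {m : ℕ} {u g : R}
    (hu : u ∈ orderLT K D H m) (hg : g ∈ genSpan K D I H) :
    D * u * g ∈ orderLT K D H (m + 2) := by
  rw [mul_assoc]
  -- The extra `D` on the left raises the order by one and so leaves a `D` to cancel a possible `I`
  -- in `g`, even against terms of order zero.
  refine mul_mem_of_mem_genSpan_right (S := (orderLT K D H (m + 2)).comap (LinearMap.mulLeft K D))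
    ?_ ?_ ?_ ?_ hg
  · exact orderLT_mono (Nat.le_succ _) (h.D_mul_mem_orderLT hu)
  · refine mul_mem_of_mem_span_right ?_ hu
    rintro _ ⟨p, j, hj, rfl⟩
    rw [Submodule.mem_comap, LinearMap.mulLeft_apply, mul_assoc, ← pow_succ,
      h.D_mul_aeval_mul_D_pow]
    exact aeval_mul_pow_mem_orderLT _ (by omega)
  · refine mul_mem_of_mem_span_right ?_ hu
    rintro _ ⟨p, j, hj, rfl⟩
    rw [Submodule.mem_comap, LinearMap.mulLeft_apply, ← mul_assoc, h.D_mul_aeval_mul_D_pow,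
      mul_assoc, pow_succ, mul_assoc, h.D_mul_I, mul_one]
    exact aeval_mul_pow_mem_orderLT _ (by omega)
  · refine mul_mem_of_mem_span_right ?_ hu
    rintro _ ⟨p, j, hj, rfl⟩
    have : aeval H p * D ^ j * H = aeval H (p * (X + C (j : K))) * D ^ j := by
      rw [mul_assoc, h.D_pow_mul_H, map_mul, map_add, aeval_X, aeval_C, mul_assoc]
    rw [Submodule.mem_comap, LinearMap.mulLeft_apply, this, h.D_mul_aeval_mul_D_pow]
    exact aeval_mul_pow_mem_orderLT _ (by omega)

theorem exists_D_pow_mul_mem_orderLT (h : IsIntegroDiffGen K D I H P) {n : ℕ} {a : R}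
    (ha : a ∈ genSpan K D I H ^ n) : ∃ m, D ^ n * a ∈ orderLT K D H m := by
  induction n generalizing a with
  | zero =>
    rw [pow_zero, Submodule.mem_one] at ha
    obtain ⟨c, rfl⟩ := ha
    refine ⟨1, ?_⟩
    have := aeval_mul_pow_mem_orderLT (D := D) (H := H) (C c) Nat.zero_lt_one
    simpa using this
  | succ n ih =>
    rw [pow_succ] at ha
    induction ha using Submodule.mul_induction_on' with
    | mem_mul_mem c hc g hg =>
      obtain ⟨m, hm⟩ := ih hc
      refine ⟨m + 2, ?_⟩
      have := h.mul_mem_orderLT_of_mem_genSpan hm hg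
      rwa [← mul_assoc, ← pow_succ', mul_assoc] at this
    | add x _ y _ hx hy =>
      obtain ⟨m, hm⟩ := hx
      obtain ⟨k, hk⟩ := hy
      refine ⟨max m k, ?_⟩
      rw [mul_add]
      exact Submodule.add_mem _ (orderLT_mono (le_max_left _ _) hm)
        (orderLT_mono (le_max_right _ _) hk)

theorem exists_hasLead_of_mem_orderLT_succ {m : ℕ} {u : R} (hu : u ∈ orderLT K D H (m + 1)) :
    ∃ p : K[X], HasLead D H m p u := by
  unfold HasLead
  induction hu using Submodule.span_induction with
  | mem x hx =>
    obtain ⟨p, j, hj, rfl⟩ := hx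
    rcases (Nat.lt_succ_iff_lt_or_eq.1 hj) with hj | rfl
    · exact ⟨0, by simpa using aeval_mul_pow_mem_orderLT p hj⟩
    · exact ⟨p, by simp⟩
  | zero => exact ⟨0, by simp⟩
  | add x y _ _ hx hy =>
    obtain ⟨p, hp⟩ := hx
    obtain ⟨q, hq⟩ := hy
    refine ⟨p + q, ?_⟩
    rw [map_add, add_mul, add_sub_add_comm]
    exact Submodule.add_mem _ hp hq
  | smul c x _ hx =>
    obtain ⟨p, hp⟩ := hx
    refine ⟨c • p, ?_⟩
    rw [map_smul, smul_mul_assoc, ← smul_sub]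
    exact Submodule.smul_mem _ _ hp

theorem exists_hasLead_of_mem_orderLT {m : ℕ} {u : R} (hu : u ∈ orderLT K D H m) (h0 : u ≠ 0) :
    ∃ (k : ℕ) (p : K[X]), p ≠ 0 ∧ HasLead D H k p u := by
  induction m with
  | zero =>
    refine absurd ?_ h0
    have : {x : R | ∃ (p : K[X]) (j : ℕ), j < 0 ∧ x = aeval H p * D ^ j} = ∅ := by
      ext; simp
    rwa [orderLT, this, Submodule.span_empty, Submodule.mem_bot] at hu
  | succ m ih =>
    obtain ⟨p, hp⟩ := exists_hasLead_of_mem_orderLT_succ hu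
    by_cases hp0 : p = 0
    · refine ih ?_
      simpa [HasLead, hp0] using hp
    · exact ⟨m, p, hp0, hp⟩

theorem exists_hasLead (h : IsIntegroDiffGen K D I H P) {a : R} (ha : ∀ n, D ^ n * a ≠ 0) :
    ∃ (n m : ℕ) (p : K[X]), p ≠ 0 ∧ HasLead D H m p (D ^ n * a) := by
  obtain ⟨n, hn⟩ := h.exists_mem_genSpan_pow a
  obtain ⟨m, hm⟩ := h.exists_D_pow_mul_mem_orderLT hn
  exact ⟨n, exists_hasLead_of_mem_orderLT hm (ha n)⟩

theorem exists_eval_natCast_add_ne_zero [CharZero K] {p : K[X]} (hp : p ≠ 0) (c : K) :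
    ∃ T : ℕ, ∀ t, T ≤ t → p.eval ((t : K) + c) ≠ 0 := by
  have hfin : {t : ℕ | p.eval ((t : K) + c) = 0}.Finite := by
    refine Set.Finite.preimage (f := fun t : ℕ => (t : K) + c) (s := {x | p.IsRoot x}) ?_
      (Polynomial.finite_setOfPred_isRoot hp)
    intro s _ t _ hst
    simpa using hst
  obtain ⟨T, hT⟩ := hfin.bddAbove
  refine ⟨T + 1, fun t ht h0 => ?_⟩
  have := hT h0
  omega

/-- Sandwiching `u` as `P * D ^ t * u * I ^ (t + m)` kills the terms of lower order, as `P * I = 0`,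
and leaves `p(t + 1) • P`. This is nonzero for large `t`. -/
theorem ne_zero_of_hasLead [CharZero K] (h : IsIntegroDiffGen K D I H P) {m : ℕ} {p : K[X]} {u : R}
    (hp : p ≠ 0) (hu : HasLead D H m p u) : u ≠ 0 := by
  rintro rfl
  obtain ⟨t, ht⟩ := exists_eval_natCast_add_ne_zero hp 1
  have hword : ∀ (q : K[X]) (j k : ℕ), P * (D ^ t * (aeval H q * D ^ j)) * I ^ (t + j + k) =
      q.eval ((t : K) + 1) • (P * I ^ k) := fun q j k => by
    rw [h.D_pow_mul_aeval_mul_D_pow, ← mul_assoc, h.P_mul_aeval, mul_assoc,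
      h.D_pow_mul_I_pow_add, smul_mul_assoc]
    simp [add_comm]
  have hlow : ∀ x ∈ orderLT K D H m, P * (D ^ t * x) * I ^ (t + m) = 0 := fun x hx => by
    induction hx using Submodule.span_induction with
    | mem x hx =>
      obtain ⟨q, j, hj, rfl⟩ := hx
      obtain ⟨k, rfl⟩ := Nat.exists_eq_add_of_lt hj
      rw [← add_assoc, ← add_assoc, add_assoc _ k, hword, h.P_mul_I_pow (Nat.succ_pos _), smul_zero]
    | zero => simp
    | add x y _ _ hx hy => rw [mul_add, mul_add, add_mul, hx, hy, add_zero]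
    | smul c x _ hx => rw [mul_smul_comm, mul_smul_comm, smul_mul_assoc, hx, smul_zero]
  have := hlow _ hu
  have h2 := hword p m 0
  rw [add_zero, pow_zero, mul_one] at h2
  rw [zero_sub, mul_neg, mul_neg, neg_mul, h2, neg_eq_zero] at this
  exact (smul_ne_zero (ht t le_rfl) h.P_ne_zero) this

theorem mul_mem_orderLT (h : IsIntegroDiffGen K D I H P) {m n k : ℕ} {u v : R}
    (hu : u ∈ orderLT K D H m) (hv : v ∈ orderLT K D H n) (hk : m + n ≤ k + 1) :
    u * v ∈ orderLT K D H k := by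
  refine mul_mem_of_mem_span_right ?_ hu
  rintro _ ⟨p, i, hi, rfl⟩
  refine mul_mem_of_mem_span ?_ hv
  rintro _ ⟨q, j, hj, rfl⟩
  rw [mul_assoc, h.D_pow_mul_aeval_mul_D_pow, ← mul_assoc, ← map_mul]
  exact aeval_mul_pow_mem_orderLT _ (by omega)

theorem mem_orderLT_of_hasLead {m : ℕ} {p : K[X]} {u : R} (hu : HasLead D H m p u) :
    u ∈ orderLT K D H (m + 1) := by
  rw [← sub_add_cancel u (aeval H p * D ^ m)]
  exact Submodule.add_mem _ (orderLT_mono (Nat.le_succ _) hu)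
    (aeval_mul_pow_mem_orderLT _ (Nat.lt_succ_self _))

theorem hasLead_mul (h : IsIntegroDiffGen K D I H P) {m n : ℕ} {p q : K[X]} {u v : R}
    (hu : HasLead D H m p u) (hv : HasLead D H n q v) :
    HasLead D H (m + n) (p * q.comp (X + C (m : K))) (u * v) := by
  have hmul : aeval H (p * q.comp (X + C (m : K))) * D ^ (m + n) =
      aeval H p * D ^ m * (aeval H q * D ^ n) := by
    rw [mul_assoc, h.D_pow_mul_aeval_mul_D_pow, map_mul, mul_assoc]
  have : u * v - aeval H p * D ^ m * (aeval H q * D ^ n) =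
      (u - aeval H p * D ^ m) * v + aeval H p * D ^ m * (v - aeval H q * D ^ n) := by
    noncomm_ring
  unfold HasLead
  rw [hmul, this]
  exact Submodule.add_mem _ (h.mul_mem_orderLT hu (mem_orderLT_of_hasLead hv) (by omega))
    (h.mul_mem_orderLT (aeval_mul_pow_mem_orderLT p (Nat.lt_succ_self m)) hv (by omega))

theorem exists_mul_D_pow_of_mem_orderLT (h : IsIntegroDiffGen K D I H P) {m : ℕ} {u : R}
    (hu : u ∈ orderLT K D H m) (n : ℕ) : ∃ v ∈ orderLT K D H m, D ^ n * u = v * D ^ n := by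
  induction hu using Submodule.span_induction with
  | mem x hx =>
    obtain ⟨q, j, hj, rfl⟩ := hx
    refine ⟨_, aeval_mul_pow_mem_orderLT (q.comp (X + C (n : K))) hj, ?_⟩
    rw [h.D_pow_mul_aeval_mul_D_pow, mul_assoc, ← pow_add, add_comm n j]
  | zero => exact ⟨0, Submodule.zero_mem _, by simp⟩
  | add x y _ _ hx hy =>
    obtain ⟨v, hv, hxv⟩ := hx
    obtain ⟨w, hw, hyw⟩ := hy
    exact ⟨v + w, Submodule.add_mem _ hv hw, by rw [mul_add, add_mul, hxv, hyw]⟩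
  | smul c x _ hx =>
    obtain ⟨v, hv, hxv⟩ := hx
    exact ⟨c • v, Submodule.smul_mem _ _ hv, by rw [mul_smul_comm, smul_mul_assoc, hxv]⟩

theorem exists_hasLead_mul_D_pow (h : IsIntegroDiffGen K D I H P) {m : ℕ} {p : K[X]} {u : R}
    (hu : HasLead D H m p u) (n : ℕ) :
    ∃ v, HasLead D H m (p.comp (X + C (n : K))) v ∧ D ^ n * u = v * D ^ n := by
  obtain ⟨v, hv, huv⟩ := h.exists_mul_D_pow_of_mem_orderLT hu n
  refine ⟨v + aeval H (p.comp (X + C (n : K))) * D ^ m, by simpa [HasLead] using hv, ?_⟩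
  rw [mul_sub, sub_eq_iff_eq_add, h.D_pow_mul_aeval_mul_D_pow] at huv
  rw [huv, add_mul, mul_assoc _ (D ^ m), ← pow_add, add_comm n m]

/-- Otherwise suitable powers of `D` turn both `a` and `b` into differential operators with nonzero
leading coefficient. The power of `D` needed next to `a` is produced by moving it through the
operator obtained from `b`, and leading coefficients multiply up to translation. -/
theorem exists_D_pow_mul_eq_zero_of_mul_eq_zero [CharZero K] (h : IsIntegroDiffGen K D I H P)
    {a b : R} (ha : ∀ n, D ^ n * a ≠ 0) (hba : b * a = 0) : ∃ n, D ^ n * b = 0 := by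
  by_contra! hb
  obtain ⟨n, m, p, hp, hu⟩ := h.exists_hasLead ha
  obtain ⟨k, l, q, hq, hw⟩ := h.exists_hasLead hb
  obtain ⟨v, hv, hwv⟩ := h.exists_hasLead_mul_D_pow hw n
  refine h.ne_zero_of_hasLead ?_ (h.hasLead_mul hv hu) ?_
  · exact mul_ne_zero (comp_X_add_C_ne_zero_iff.2 hq) (comp_X_add_C_ne_zero_iff.2 hp)
  · rw [← mul_assoc, ← hwv, mul_assoc, mul_assoc, hba, mul_zero, mul_zero]

/-- Eventually, right multiplication by `a` is injective on the successive quotients of the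
annihilators of the powers of `I`. -/
theorem exists_forall_mul_I_pow_eq_zero [CharZero K] (h : IsIntegroDiffGen K D I H P)
    {a : R} (ha : ∀ n, D ^ n * a ≠ 0) :
    ∃ J, ∀ j, J ≤ j → ∀ b, b * I ^ (j + 1) = 0 → b * a = 0 → b * I ^ j = 0 := by
  obtain ⟨n, m, p, hp, hu⟩ := h.exists_hasLead ha
  obtain ⟨T, hT⟩ := exists_eval_natCast_add_ne_zero hp 1
  -- The difference between `a` and `I ^ n * (D ^ n * a)` is killed by `D ^ n` on the left, hence by
  -- some `I ^ s` on the right, so only the differential operator `D ^ n * a` matters.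
  have hfin : ∃ k, D ^ k * ((1 - I ^ n * D ^ n) * a) = 0 :=
    ⟨n, by rw [sub_mul, mul_sub, one_mul, mul_assoc (I ^ n), ← mul_assoc (D ^ n) (I ^ n),
      h.D_pow_mul_I_pow, one_mul, sub_self]⟩
  obtain ⟨s, hs⟩ := (h.exists_D_pow_mul_eq_zero_iff _).1 hfin
  refine ⟨n + s + T, fun j hj b hbj hba => ?_⟩
  obtain ⟨t, rfl⟩ : ∃ t, j = n + t := ⟨j - n, by omega⟩
  -- Since one further `I` kills `b * I ^ j`, right multiplication by `P` fixes it. Then `H` acts on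
  -- it as the scalar one, and a polynomial in `H` as its value at one.
  have hbP : b * I ^ (n + t) * P = b * I ^ (n + t) := by
    have : P = 1 - I * D := by rw [h.I_mul_D, sub_sub_cancel]
    rw [this, mul_sub, mul_one, ← mul_assoc, mul_assoc b, ← pow_succ, hbj, zero_mul, sub_zero]
  have hbI : ∀ k, b * I ^ (n + t + 1 + k) = 0 := fun k => by
    rw [pow_add, ← mul_assoc, hbj, zero_mul]
  have hword : ∀ (q : K[X]) (i k : ℕ), b * I ^ n * (aeval H q * D ^ i) * I ^ (i + (t + k)) =
      b * I ^ (n + t + k) * aeval H (q.comp (X + C ((t + k : ℕ) : K))) := fun q i k => by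
    rw [mul_assoc, mul_assoc (aeval H q), h.D_pow_mul_I_pow_add, h.aeval_mul_I_pow, mul_assoc b,
      ← mul_assoc (I ^ n), ← pow_add, ← mul_assoc, add_assoc]
  have hlow : ∀ x ∈ orderLT K D H m, b * I ^ n * x * I ^ (m + t) = 0 := fun x hx => by
    induction hx using Submodule.span_induction with
    | mem x hx =>
      obtain ⟨q, i, hi, rfl⟩ := hx
      obtain ⟨k, rfl⟩ := Nat.exists_eq_add_of_lt hi
      have : i + k + 1 + t = i + (t + (1 + k)) := by omega
      rw [this, hword, ← add_assoc, hbI, zero_mul]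
    | zero => simp
    | add x y _ _ hx hy => rw [mul_add, add_mul, hx, hy, add_zero]
    | smul c x _ hx => rw [mul_smul_comm, smul_mul_assoc, hx, smul_zero]
  have hzero : b * I ^ n * (D ^ n * a) * I ^ (m + t) = 0 := by
    have h1 : b * I ^ n * (D ^ n * a) = b * a - b * ((1 - I ^ n * D ^ n) * a) := by noncomm_ring
    have h2 : (1 - I ^ n * D ^ n) * a * I ^ (m + t) = 0 := by
      have : m + t = s + (m + t - s) := by omega
      rw [this, pow_add, ← mul_assoc, hs, zero_mul]
    rw [h1, hba, zero_sub, neg_mul, mul_assoc b, h2, mul_zero, neg_zero]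
  -- Only the leading term survives, so `p(t + 1) • (b * I ^ j) = 0`, with nonzero scalar because `t
  -- ≥ T`.
  have htop := hword p m 0
  rw [add_zero, add_zero, ← hbP, mul_assoc _ P, h.P_mul_aeval, mul_smul_comm, hbP] at htop
  have := hlow _ hu
  rw [mul_sub, sub_mul, hzero, htop, zero_sub, neg_eq_zero] at this
  refine (smul_eq_zero.1 this).resolve_left ?_
  have hne := hT t (by omega)
  simpa [add_comm] using hne

/-- Every `b` with `b * a = 0` is killed by some power of `I`, depending on `b`. Injectivity on the
successive quotients lowers the exponent to the uniform `J`. -/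
theorem exists_ker_le_ker_I_pow [CharZero K] (h : IsIntegroDiffGen K D I H P)
    {a : R} (ha : ∀ n, D ^ n * a ≠ 0) :
    ∃ J, LinearMap.ker (rightMulMap a) ≤ LinearMap.ker (rightMulMap (I ^ J)) := by
  obtain ⟨J, hJ⟩ := h.exists_forall_mul_I_pow_eq_zero ha
  refine ⟨J, fun b (hba : b * a = 0) => ?_⟩
  change b * I ^ J = 0
  obtain ⟨k, hk⟩ := (h.exists_D_pow_mul_eq_zero_iff b).1
    (h.exists_D_pow_mul_eq_zero_of_mul_eq_zero ha hba)
  replace hk : b * I ^ (J + k) = 0 := by rw [add_comm, pow_add, ← mul_assoc, hk, zero_mul]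
  induction k with
  | zero => exact hk
  | succ k ih => exact ih (hJ _ (by omega) b hk hba)

/-! ### Lengths -/

theorem length_ker_I_pow_lt_top [CharZero K] (h : IsIntegroDiffGen K D I H P) (J : ℕ) :
    Module.length R (LinearMap.ker (rightMulMap (I ^ J))) < ⊤ := by
  set L := LinearMap.ker (rightMulMap (I ^ J)) with hL
  let f : L →ₗ[K] R := L.subtype.restrictScalars K
  have hf : Function.Injective f := Subtype.val_injective
  have hmap : ∀ n, ((genSpan K D I H ^ n).comap f).map f ≤
      genSpan K D I H ^ n ⊓ L.restrictScalars K := by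
    rintro n _ ⟨x, hx, rfl⟩
    exact ⟨hx, x.2⟩
  have hfd : ∀ n, FiniteDimensional K ↥(genSpan K D I H ^ n ⊓ L.restrictScalars K) := fun n =>
    have := finiteDimensional_genSpan_pow (K := K) (D := D) (I := I) (H := H) n
    Submodule.finiteDimensional_inf_left _ _
  have e := fun n => Submodule.equivMapOfInjective f hf ((genSpan K D I H ^ n).comap f)
  have hfil : IsLinearFiltration K D I H (fun n => (genSpan K D I H ^ n).comap f) J
      (J * (J + 1)) :=
    { exhaustive := fun x => h.exists_mem_genSpan_pow (x : R)
      smul_mem := fun hw hx => mul_mem_genSpan_pow hw hx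
      finiteDimensional := fun n => by
        have := Submodule.finiteDimensional_of_le (hmap n)
        exact (e n).symm.finiteDimensional
      finrank_le := fun n => by
        rw [(e n).finrank_eq]
        refine (Submodule.finrank_mono (hmap n)).trans ((h.finrank_inf_ker_I_pow_le n J).trans ?_)
        exact le_of_eq (by ring) }
  exact hfil.length_lt_top h

theorem length_lt_top_of_le_ker_I_pow [CharZero K] (h : IsIntegroDiffGen K D I H P) {J : ℕ}
    {L : Submodule R R} (hL : L ≤ LinearMap.ker (rightMulMap (I ^ J))) :
    Module.length R L < ⊤ :=
  lt_of_le_of_lt (Module.length_le_of_injective (Submodule.inclusion hL)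
    (Submodule.inclusion_injective hL)) (h.length_ker_I_pow_lt_top J)

/-- The left annihilators of the `I ^ J` increase strictly: `P * D ^ J` kills `I ^ (J + 1)` but not
`I ^ J`. -/
theorem length_eq_top (h : IsIntegroDiffGen K D I H P) : Module.length R R = ⊤ := by
  by_contra hne
  have hfin := (isFiniteLength_iff_isNoetherian_isArtinian.1 (Module.length_ne_top_iff.1 hne)).1
  refine not_strictMono_of_wellFoundedGT (fun J => LinearMap.ker (rightMulMap (I ^ J)))
    (strictMono_nat_of_lt_succ fun J => SetLike.lt_iff_le_and_exists.2 ⟨?_, P * D ^ J, ?_, ?_⟩)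
  · intro b (hb : b * I ^ J = 0)
    change b * I ^ (J + 1) = 0
    rw [pow_succ, ← mul_assoc, hb, zero_mul]
  · change P * D ^ J * I ^ (J + 1) = 0
    rw [mul_assoc, h.D_pow_mul_I_pow_add, pow_one, h.P_mul_I]
  · change ¬ (P * D ^ J * I ^ J = 0)
    rw [mul_assoc, h.D_pow_mul_I_pow, mul_one]
    exact h.P_ne_zero

theorem length_ker_lt_top [CharZero K] (h : IsIntegroDiffGen K D I H P)
    {a : R} (ha : ∀ n, D ^ n * a ≠ 0) : Module.length R (LinearMap.ker (rightMulMap a)) < ⊤ := by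
  obtain ⟨J, hJ⟩ := h.exists_ker_le_ker_I_pow ha
  exact h.length_lt_top_of_le_ker_I_pow hJ

theorem length_range_lt_top [CharZero K] (h : IsIntegroDiffGen K D I H P)
    {a : R} (ha : ∃ n, D ^ n * a = 0) :
    Module.length R (LinearMap.range (rightMulMap a)) < ⊤ := by
  obtain ⟨J, hJ⟩ := (h.exists_D_pow_mul_eq_zero_iff a).1 ha
  refine h.length_lt_top_of_le_ker_I_pow (J := J) ?_
  rintro _ ⟨b, rfl⟩
  change b * a * I ^ J = 0
  rw [mul_assoc, hJ, mul_zero]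

/-- With `V` the generating space, `V ^ n * a` lies in `V ^ (n + d)` and dies in the cokernel. What
remains is at most the growth from `V ^ n` to `V ^ (n + d)`, linear in `n`, plus the kernel of
multiplication by `a` on `V ^ n`. -/
theorem finrank_map_mkQ_le (h : IsIntegroDiffGen K D I H P) {a : R} {d J : ℕ}
    (had : a ∈ genSpan K D I H ^ d)
    (hJ : LinearMap.ker (rightMulMap a) ≤ LinearMap.ker (rightMulMap (I ^ J))) (n : ℕ) :
    Module.finrank K ((genSpan K D I H ^ (n + d)).map
      ((LinearMap.range (rightMulMap a)).mkQ.restrictScalars K)) ≤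
      d * (3 * (n + d + 1)) + J * (n + J + 1) := by
  have hfd := fun n => finiteDimensional_genSpan_pow (K := K) (D := D) (I := I) (H := H) n
  have := hfd n
  have := hfd (n + d)
  set V := genSpan K D I H with hV
  set L := LinearMap.range (rightMulMap a) with hL
  let f : ↥(V ^ (n + d)) →ₗ[K] R ⧸ L := (L.mkQ.restrictScalars K).comp (V ^ (n + d)).subtype
  let g : ↥(V ^ n) →ₗ[K] R := (LinearMap.mulRight K a).comp (V ^ n).subtype
  have hrf : (V ^ (n + d)).map (L.mkQ.restrictScalars K) = LinearMap.range f := by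
    rw [LinearMap.range_comp, Submodule.range_subtype]
  have h1 := LinearMap.finrank_range_add_finrank_ker f
  have h2 := LinearMap.finrank_range_add_finrank_ker g
  have h3 : Module.finrank K (LinearMap.range g) ≤ Module.finrank K (LinearMap.ker f) := by
    have hle : LinearMap.range g ≤ (LinearMap.ker f).map (V ^ (n + d)).subtype := by
      rintro _ ⟨x, rfl⟩
      refine ⟨⟨x * a, mul_mem_genSpan_pow x.2 had⟩, ?_, rfl⟩
      have : L.mkQ ((x : R) * a) = 0 :=
        (Submodule.Quotient.mk_eq_zero L).2 ⟨(x : R), rfl⟩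
      exact this
    exact (Submodule.finrank_mono hle).trans (Submodule.finrank_map_le _ _)
  have h4 : Module.finrank K (LinearMap.ker g) ≤ J * (n + J + 1) := by
    refine le_trans ?_ (h.finrank_inf_ker_I_pow_le n J)
    have hle : (LinearMap.ker g).map (V ^ n).subtype ≤
        V ^ n ⊓ (LinearMap.ker (rightMulMap (I ^ J))).restrictScalars K := by
      rintro _ ⟨x, hx, rfl⟩
      exact ⟨x.2, hJ (show (x : R) * a = 0 from hx)⟩
    have : FiniteDimensional K
        ↥(V ^ n ⊓ (LinearMap.ker (rightMulMap (I ^ J))).restrictScalars K) :=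
      Submodule.finiteDimensional_inf_left _ _
    refine le_trans (le_of_eq ?_) (Submodule.finrank_mono hle)
    exact (Submodule.equivMapOfInjective _ Subtype.val_injective _).finrank_eq
  have h5 := h.finrank_genSpan_pow_add_le n d
  rw [hrf]
  rw [← hV] at h5
  omega

theorem length_coker_lt_top [CharZero K] (h : IsIntegroDiffGen K D I H P)
    {a : R} (ha : ∀ n, D ^ n * a ≠ 0) :
    Module.length R (R ⧸ LinearMap.range (rightMulMap a)) < ⊤ := by
  obtain ⟨J, hJ⟩ := h.exists_ker_le_ker_I_pow ha
  obtain ⟨d, hd⟩ := h.exists_mem_genSpan_pow a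
  have hfil : IsLinearFiltration K D I H (fun n => (genSpan K D I H ^ (n + d)).map
      ((LinearMap.range (rightMulMap a)).mkQ.restrictScalars K)) (3 * d + J)
      (3 * d * (d + 1) + J * (J + 1)) :=
    { exhaustive := fun x => by
        obtain ⟨y, rfl⟩ := Submodule.mkQ_surjective _ x
        obtain ⟨n, hn⟩ := h.exists_mem_genSpan_pow y
        exact ⟨n, y, mem_genSpan_pow_of_le (Nat.le_add_right _ _) hn, rfl⟩
      smul_mem := by
        rintro k n w _ hw ⟨y, hy, rfl⟩
        refine ⟨w * y, ?_, rfl⟩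
        rw [add_assoc]
        exact mul_mem_genSpan_pow hw hy
      finiteDimensional := fun n => by
        have := finiteDimensional_genSpan_pow (K := K) (D := D) (I := I) (H := H) (n + d)
        infer_instance
      finrank_le := fun n => (h.finrank_map_mkQ_le hd hJ n).trans (le_of_eq (by ring)) }
  exact hfil.length_lt_top h

theorem length_iff [CharZero K] (h : IsIntegroDiffGen K D I H P) (a : R) :
    (Module.length R (LinearMap.ker (rightMulMap a)) < ⊤ ↔ ¬ ∃ n, D ^ n * a = 0) ∧
    (Module.length R (R ⧸ LinearMap.range (rightMulMap a)) < ⊤ ↔ ¬ ∃ n, D ^ n * a = 0) ∧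
    (Module.length R (LinearMap.range (rightMulMap a)) < ⊤ ↔ ∃ n, D ^ n * a = 0) := by
  have hker : Module.length R (LinearMap.ker (rightMulMap a)) +
      Module.length R (LinearMap.range (rightMulMap a)) = ⊤ := by
    rw [← h.length_eq_top]
    exact (Module.length_eq_add_of_exact _ (rightMulMap a).rangeRestrict
      (Submodule.subtype_injective _) (rightMulMap a).surjective_rangeRestrict
      (by rw [LinearMap.exact_iff, LinearMap.ker_rangeRestrict, Submodule.range_subtype])).symm
  have hcoker : Module.length R (LinearMap.range (rightMulMap a)) +
      Module.length R (R ⧸ LinearMap.range (rightMulMap a)) = ⊤ := by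
    rw [← h.length_eq_top]
    exact (Module.length_eq_add_of_exact _ _ (Submodule.subtype_injective _)
      (Submodule.mkQ_surjective _) (LinearMap.exact_subtype_mkQ _)).symm
  by_cases ha : ∃ n, D ^ n * a = 0
  · have hr := h.length_range_lt_top ha
    have h1 := (WithTop.add_eq_top.1 hker).resolve_right hr.ne
    have h2 := (WithTop.add_eq_top.1 hcoker).resolve_left hr.ne
    exact ⟨iff_of_false (fun hlt => hlt.ne h1) (not_not_intro ha),
      iff_of_false (fun hlt => hlt.ne h2) (not_not_intro ha), iff_of_true hr ha⟩
  · have ha' : ∀ n, D ^ n * a ≠ 0 := fun n hn => ha ⟨n, hn⟩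
    have hk := h.length_ker_lt_top ha'
    have hc := h.length_coker_lt_top ha'
    have h1 := (WithTop.add_eq_top.1 hker).resolve_left hk.ne
    exact ⟨iff_of_true hk ha, iff_of_true hc ha, iff_of_false (fun hlt => hlt.ne h1) ha⟩

end IsIntegroDiffGen

/-! ### The concrete algebra satisfies the presentation -/

namespace IntegroDiff

variable {K : Type*} [Field K]

/-- The inclusion of the algebra of integro-differential operators into all operators. -/
noncomputable def toEnd (K : Type*) [Field K] : IntegroDiff K →ₐ[K] Module.End K K[X] :=
  (integroDiffSubalgebra K).val

theorem toEnd_injective : Function.Injective (toEnd K) := Subtype.val_injective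

/-- Multiplication by `x` as an element of the algebra of integro-differential operators. -/
noncomputable def mulX (K : Type*) [Field K] : IntegroDiff K :=
  (⟨polyMulX K, Algebra.subset_adjoin (by simp)⟩ : integroDiffSubalgebra K)

theorem ext_X_pow {a b : IntegroDiff K} (h : ∀ n : ℕ, toEnd K a (X ^ n) = toEnd K b (X ^ n)) :
    a = b := by
  refine toEnd_injective (Polynomial.lhom_ext' fun n => LinearMap.ext_ring ?_)
  simpa [Polynomial.monomial_one_right_eq_X_pow] using h n

theorem toEnd_int_X_pow (n : ℕ) :
    toEnd K (int K) (X ^ n) = ((n : K) + 1)⁻¹ • X ^ (n + 1) := by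
  rw [smul_eq_C_mul]
  exact polyInt_X_pow K n

theorem toEnd_der_X_pow_succ (n : ℕ) :
    toEnd K (der K) (X ^ (n + 1)) = ((n : K) + 1) • X ^ n := by
  change derivative (X ^ (n + 1) : K[X]) = _
  simp [smul_eq_C_mul]

theorem toEnd_der_X_pow_zero : toEnd K (der K) (X ^ 0) = 0 := by
  change derivative (X ^ 0 : K[X]) = _
  simp

theorem toEnd_mulX_X_pow (n : ℕ) : toEnd K (mulX K) (X ^ n) = X ^ (n + 1) :=
  (pow_succ' X n).symm

theorem toEnd_der_mul_mulX_X_pow (n : ℕ) :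
    toEnd K (der K * mulX K) (X ^ n) = ((n : K) + 1) • X ^ n := by
  rw [map_mul, Module.End.mul_apply, toEnd_mulX_X_pow, toEnd_der_X_pow_succ]

theorem toEnd_one_sub_int_mul_der_X_pow_zero :
    toEnd K (1 - int K * der K) (X ^ 0) = X ^ 0 := by
  rw [map_sub, map_mul, LinearMap.sub_apply, Module.End.mul_apply, toEnd_der_X_pow_zero, map_zero,
    sub_zero, map_one, Module.End.one_apply]

section CharZero

variable [CharZero K]

theorem der_mul_int : der K * int K = 1 := ext_X_pow fun n => by
  rw [map_mul, Module.End.mul_apply, toEnd_int_X_pow, map_smul, toEnd_der_X_pow_succ, smul_smul,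
    inv_mul_cancel₀ (Nat.cast_add_one_ne_zero n), one_smul, map_one, Module.End.one_apply]

theorem toEnd_int_mul_der_X_pow_succ (n : ℕ) :
    toEnd K (int K * der K) (X ^ (n + 1)) = X ^ (n + 1) := by
  rw [map_mul, Module.End.mul_apply, toEnd_der_X_pow_succ, map_smul, toEnd_int_X_pow, smul_smul,
    mul_inv_cancel₀ (Nat.cast_add_one_ne_zero n), one_smul]

/-- Integration undoes differentiation on polynomials without constant term, such as multiples of
`x`. Hence `x` is recovered from `I` and `H`. -/
theorem int_mul_der_mul_mulX : int K * (der K * mulX K) = mulX K := ext_X_pow fun n => by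
  rw [← mul_assoc, map_mul, Module.End.mul_apply, toEnd_mulX_X_pow, toEnd_int_mul_der_X_pow_succ]

theorem adjoin_eq_top : Algebra.adjoin K {der K, int K, der K * mulX K} = ⊤ := by
  have hD : der K ∈ Algebra.adjoin K {der K, int K, der K * mulX K} :=
    Algebra.subset_adjoin (by simp)
  have hI : int K ∈ Algebra.adjoin K {der K, int K, der K * mulX K} :=
    Algebra.subset_adjoin (by simp)
  have hH : der K * mulX K ∈ Algebra.adjoin K {der K, int K, der K * mulX K} :=
    Algebra.subset_adjoin (by simp)
  have hX : mulX K ∈ Algebra.adjoin K {der K, int K, der K * mulX K} := by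
    have := Subalgebra.mul_mem _ hI hH
    rwa [int_mul_der_mul_mulX] at this
  rw [eq_top_iff]
  rintro ⟨a, ha⟩ -
  induction ha using Algebra.adjoin_induction with
  | mem x hx =>
    rcases hx with rfl | rfl | rfl
    · exact hX
    · exact hD
    · exact hI
  | algebraMap r => exact Subalgebra.algebraMap_mem _ r
  | add x y _ _ hx hy => exact Subalgebra.add_mem _ hx hy
  | mul x y _ _ hx hy => exact Subalgebra.mul_mem _ hx hy

theorem toEnd_one_sub_int_mul_der_X_pow_succ (n : ℕ) :
    toEnd K (1 - int K * der K) (X ^ (n + 1)) = 0 := by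
  rw [map_sub, LinearMap.sub_apply, toEnd_int_mul_der_X_pow_succ, map_one, Module.End.one_apply,
    sub_self]

theorem isIntegroDiffGen :
    IsIntegroDiffGen K (der K) (int K) (der K * mulX K) (1 - int K * der K) where
  D_mul_I := der_mul_int
  I_mul_D := (sub_sub_cancel _ _).symm
  H_mul_I := ext_X_pow fun n => by
    rw [map_mul, Module.End.mul_apply, toEnd_int_X_pow, map_smul, toEnd_der_mul_mulX_X_pow,
      map_mul, Module.End.mul_apply, map_add, LinearMap.add_apply, toEnd_der_mul_mulX_X_pow,
      map_one, Module.End.one_apply, map_add, map_smul, toEnd_int_X_pow]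
    push_cast
    module
  D_mul_H := ext_X_pow fun n => by
    rw [map_mul, Module.End.mul_apply, toEnd_der_mul_mulX_X_pow, map_smul, map_mul,
      Module.End.mul_apply]
    rcases n with _ | n
    · rw [toEnd_der_X_pow_zero, smul_zero, map_zero]
    · rw [toEnd_der_X_pow_succ, map_smul, map_add, LinearMap.add_apply, toEnd_der_mul_mulX_X_pow,
        map_one, Module.End.one_apply]
      push_cast
      module
  H_mul_P := ext_X_pow fun n => by
    rw [map_mul, Module.End.mul_apply]
    rcases n with _ | n
    · rw [toEnd_one_sub_int_mul_der_X_pow_zero, toEnd_der_mul_mulX_X_pow]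
      simp
    · rw [toEnd_one_sub_int_mul_der_X_pow_succ, map_zero]
  P_mul_H := ext_X_pow fun n => by
    rw [map_mul, Module.End.mul_apply, toEnd_der_mul_mulX_X_pow, map_smul]
    rcases n with _ | n
    · rw [toEnd_one_sub_int_mul_der_X_pow_zero]
      simp
    · rw [toEnd_one_sub_int_mul_der_X_pow_succ, smul_zero]
  P_ne_zero h0 := by
    have := toEnd_one_sub_int_mul_der_X_pow_zero (K := K)
    rw [h0, map_zero, LinearMap.zero_apply, pow_zero] at this
    exact zero_ne_one this
  adjoin_eq_top := adjoin_eq_top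

end CharZero

theorem e_eq (i j : ℕ) : e K i j = int K ^ i * (1 - int K * der K) * der K ^ j := by
  rw [e, pow_succ, pow_succ']
  noncomm_ring

theorem F_eq_span : F K =
    Submodule.span K {x | ∃ i j, x = int K ^ i * (1 - int K * der K) * der K ^ j} := by
  simp only [F, Submodule.iSup_span, ← e_eq]
  congr 1
  ext x
  simp [eq_comm]

theorem mem_F_iff_exists_der_pow_mul [CharZero K] (a : IntegroDiff K) :
    a ∈ F K ↔ ∃ n, der K ^ n * a = 0 := by
  rw [F_eq_span, isIntegroDiffGen.exists_D_pow_mul_eq_zero_iff_mem_span]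

theorem mem_F_iff_exists_mul_int_pow [CharZero K] (a : IntegroDiff K) :
    a ∈ F K ↔ ∃ n, a * int K ^ n = 0 := by
  rw [mem_F_iff_exists_der_pow_mul, isIntegroDiffGen.exists_D_pow_mul_eq_zero_iff]

end IntegroDiff

/-! ### Right modules as left modules over the opposite ring -/

section Opposite

variable {R : Type*} [Ring R]

/-- A ring as a right module over itself is its opposite ring as a left module over itself. -/
def opSelfLinearEquiv (R : Type*) [Ring R] : R ≃ₗ[Rᵐᵒᵖ] Rᵐᵒᵖ where
  __ := MulOpposite.opAddEquiv
  map_smul' _ _ := rfl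

theorem map_ker_leftMulMap (a : R) :
    (LinearMap.ker (leftMulMap a)).map (opSelfLinearEquiv R : R →ₗ[Rᵐᵒᵖ] Rᵐᵒᵖ) =
      LinearMap.ker (rightMulMap (MulOpposite.op a)) := by
  ext x
  constructor
  · rintro ⟨b, hb, rfl⟩
    exact congrArg MulOpposite.op hb
  · intro hx
    exact ⟨x.unop, congrArg MulOpposite.unop hx, rfl⟩

theorem map_range_leftMulMap (a : R) :
    (LinearMap.range (leftMulMap a)).map (opSelfLinearEquiv R : R →ₗ[Rᵐᵒᵖ] Rᵐᵒᵖ) =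
      LinearMap.range (rightMulMap (MulOpposite.op a)) := by
  ext x
  constructor
  · rintro ⟨_, ⟨b, rfl⟩, rfl⟩
    exact ⟨MulOpposite.op b, rfl⟩
  · rintro ⟨b, rfl⟩
    exact ⟨_, ⟨b.unop, rfl⟩, rfl⟩

theorem length_ker_leftMulMap (a : R) : Module.length Rᵐᵒᵖ (LinearMap.ker (leftMulMap a)) =
    Module.length Rᵐᵒᵖ (LinearMap.ker (rightMulMap (MulOpposite.op a))) := by
  rw [← map_ker_leftMulMap]
  exact ((opSelfLinearEquiv R).submoduleMap _).length_eq

theorem length_range_leftMulMap (a : R) : Module.length Rᵐᵒᵖ (LinearMap.range (leftMulMap a)) =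
    Module.length Rᵐᵒᵖ (LinearMap.range (rightMulMap (MulOpposite.op a))) := by
  rw [← map_range_leftMulMap]
  exact ((opSelfLinearEquiv R).submoduleMap _).length_eq

theorem length_coker_leftMulMap (a : R) :
    Module.length Rᵐᵒᵖ (R ⧸ LinearMap.range (leftMulMap a)) =
      Module.length Rᵐᵒᵖ (Rᵐᵒᵖ ⧸ LinearMap.range (rightMulMap (MulOpposite.op a))) :=
  (Submodule.Quotient.equiv _ _ (opSelfLinearEquiv R) (map_range_leftMulMap a)).length_eq

end Opposite

theorem theorem3 (K : Type*) [Field K] [CharZero K] (a : IntegroDiff K) :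
    -- kernel and cokernel of right multiplication, as left modules
    ((Module.length (IntegroDiff K) (LinearMap.ker (rightMulMap a)) < ⊤ ↔
        Module.length (IntegroDiff K) (IntegroDiff K ⧸ LinearMap.range (rightMulMap a)) < ⊤) ∧
      (Module.length (IntegroDiff K) (IntegroDiff K ⧸ LinearMap.range (rightMulMap a)) < ⊤ ↔
        a ∉ IntegroDiff.F K)) ∧
    -- image of right multiplication
    (Module.length (IntegroDiff K) (LinearMap.range (rightMulMap a)) < ⊤ ↔
      a ∈ IntegroDiff.F K) ∧
    -- kernel and cokernel of left multiplication, as right modules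
    ((Module.length (IntegroDiff K)ᵐᵒᵖ (LinearMap.ker (leftMulMap a)) < ⊤ ↔
        Module.length (IntegroDiff K)ᵐᵒᵖ (IntegroDiff K ⧸ LinearMap.range (leftMulMap a)) < ⊤) ∧
      (Module.length (IntegroDiff K)ᵐᵒᵖ (IntegroDiff K ⧸ LinearMap.range (leftMulMap a)) < ⊤ ↔
        a ∉ IntegroDiff.F K)) ∧
    -- image of left multiplication
    (Module.length (IntegroDiff K)ᵐᵒᵖ (LinearMap.range (leftMulMap a)) < ⊤ ↔
      a ∈ IntegroDiff.F K) := by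
  have h := IntegroDiff.isIntegroDiffGen (K := K)
  obtain ⟨hker, hcoker, hrange⟩ := h.length_iff a
  rw [← IntegroDiff.mem_F_iff_exists_der_pow_mul] at hker hcoker hrange
  -- In the opposite algebra the role of `D` is played by `I`, so the left-hand condition there
  -- reads `a * I ^ n = 0`, which again describes `F`.
  have hop : (∃ n, MulOpposite.op (IntegroDiff.int K) ^ n * MulOpposite.op a = 0) ↔
      a ∈ IntegroDiff.F K := by
    rw [IntegroDiff.mem_F_iff_exists_mul_int_pow]
    simp only [← MulOpposite.op_pow, ← MulOpposite.op_mul, MulOpposite.op_eq_zero_iff]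
  obtain ⟨hker', hcoker', hrange'⟩ := h.op.length_iff (MulOpposite.op a)
  rw [hop, ← length_ker_leftMulMap] at hker'
  rw [hop, ← length_coker_leftMulMap] at hcoker'
  rw [hop, ← length_range_leftMulMap] at hrange'
  exact ⟨⟨hker.trans hcoker.symm, hcoker⟩, hrange, ⟨hker'.trans hcoker'.symm, hcoker'⟩, hrange'⟩
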